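/- Let $d\in\{2,3\}$, let $k\ge 0$ be an integer and let $\varrho\in(0,1)$. Then there is a constant $C>0$ depending only on $d$, $k$ and $\varrho$ with the following property. Let $\Omega\subset\mathbb R^d$ be a bounded, simply connected polytopal domain (a polytope being a connected interior of a finite union of closed $d$-simplices), and let $\mathcal T_h$ be a mesh of $\Omega$: a finite collection of pairwise disjoint polytopes $T$ (elements, diameter $h_T$) with $\overline\Omega=\bigcup_T\overline T$, together with a finite collection $\mathcal F_h$ of pairwise disjoint faces $F$ (diameter $h_F$). Each $F$ is a relatively open subset of a hyperplane with $|F|_{d-1}>0$ and $|\overline F\setminus F|_{d-1}=0$, with $\bigcup_T\partial T=\bigcup_F\overline F$, and each $F$ is either an interface, $F\subset\partial T_1\cap\partial T_2$ with $T_1\neq T_2$ and $F\not\subset\partial\Omega$, or a boundary face, $F\subset\partial T_1\cap\partial\Omega$. Put $\mathcal F_T=\{F: F\subset\partial T\}$ and, for $F\in\mathcal F_T$, let $n_{TF}$ be the unit normal to $F$ pointing out of $T$. Assume that the mesh is regular with parameter $\varrho$: there is a conforming simplicial mesh of $\Omega$ such that each simplex $S$ lies in exactly one element, each open simplicial face is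 contained in or disjoint from each mesh face, $\varrho h_S\le r_S$ (diameter and inradius of $S$), and $\varrho h_T\le h_S$ whenever $S\subset T$. Let $\nu>0$, $f\in[L^2(\Omega)]^d$, and let $(u,p)\in[H^1_0(\Omega)]^d\times L^2_0(\Omega)$ be the weak solution of the Stokes problem, $$\nu(\nabla u,\nabla v)-(\nabla\cdot v,p)=(f,v)\ \ \forall v\in[H^1_0(\Omega)]^d,\qquad (\nabla\cdot u,q)=0\ \ \forall q\in L^2_0(\Omega).$$ Discrete velocities are families $\underline v_h=((v_T)_T,(v_F)_F)$ with $v_T\in[\mathbb P^k(T)]^d$, $v_F\in[\mathbb P^k(F)]^d$. Let $\pi^{0,k}_D$ be the $L^2(D)$-orthogonal projector on polynomials of total degree at most $k$, applied componentwise. For $\underline v_h$ and $T$ let $r_T\underline v_T\in[\mathbb P^{k+1}(T)]^d$ and $D_T\underline v_T\in\mathbb P^k(T)$ be given by $$(\nabla r_T\underline v_T,\nabla w)_T=(\nabla v_T,\nabla w)_T+\sum_{F\in\mathcal F_T}(v_F-v_T,(\nabla w)n_{TF})_F\ \ \forall w\in[\mathbb P^{k+1}(T)]^d,\qquad \int_T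 r_T\underline v_T=\int_T v_T,$$ $$(D_T\underline v_T,q)_T=(\nabla\cdot v_T,q)_T+\sum_{F\in\mathcal F_T}(v_F-v_T,q\,n_{TF})_F\ \ \forall q\in\mathbb P^k(T),$$ where $((\nabla w)n)_i=\sum_j\partial_jw_i\,n_j$. Put $\delta_T\underline v_T=\pi_T^{0,k}(r_T\underline v_T-v_T)$, $\delta_{TF}\underline v_T=\pi_F^{0,k}(r_T\underline v_T-v_F)$ and $$s_T(\underline w_T,\underline v_T)=h_T^{-2}(\delta_T\underline w_T,\delta_T\underline v_T)_T+\sum_{F\in\mathcal F_T}h_F^{-1}(\delta_{TF}\underline w_T,\delta_{TF}\underline v_T)_F .$$ Let $(\underline u_h,p_h)$ be the solution of the hybrid high-order scheme: $u_F=0$ on boundary faces, $p_h$ is a broken polynomial of degree at most $k$ with $\int_\Omega p_h=0$ and restrictions $p_T=p_h|_T$, and $$\nu\sum_T\big[(\nabla r_T\underline u_T,\nabla r_T\underline v_T)_T+s_T(\underline u_T,\underline v_T)\big]-\sum_T(D_T\underline v_T,p_T)_T=\sum_T(f,v_T)_T,\qquad \sum_T(D_T\underline u_T,q_T)_T=0$$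 for all discrete velocities $\underline v_h$ with $v_F=0$ on boundary faces and all broken polynomials $q_h$ of degree at most $k$ with zero mean. Define $$e_u^2=\sum_T\big(\nu\|\nabla u-\nabla r_T\underline u_T\|_T^2+\nu s_T(\underline u_T,\underline u_T)\big),\qquad e_p^2=\sum_T\nu^{-1}\|p-p_T\|_T^2,$$ $$\mathrm{osc}^2(f,\mathcal T_h)=\sum_T\nu^{-1}h_T^2\|f-\pi_T^{0,k}f\|_T^2,$$ $$\eta_h^2=\sum_T\Big(\nu\|\nabla\cdot r_T\underline u_T\|_T^2+\nu s_T(\underline u_T,\underline u_T)+\nu\sum_{F\in\mathcal F_T}h_F^{-1}\|[\![r_h\underline u_h]\!]_F\|_F^2\Big),$$ where $[\![r_h\underline u_h]\!]_F=r_{T_1}\underline u_{T_1}-r_{T_2}\underline u_{T_2}$ on interfaces and $[\![r_h\underline u_h]\!]_F=r_{T_1}\underline u_{T_1}$ on boundary faces. Then $$\eta_h^2\le C\,\big(e_u^2+e_p^2+\mathrm{osc}^2(f,\mathcal T_h)\big).$$ In particular $C$ is independent of the meshsize $h$ and of $\nu$, and also of $u$, $p$, $f$. -/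

import Mathlib

open MeasureTheory Filter Topology Set
open scoped ENNReal ContDiff

noncomputable section

namespace StokesHHO

/-- Points of `ℝ^d` with the Euclidean distance. -/
abbrev Pt (d : ℕ) : Type := EuclideanSpace ℝ (Fin d)

/-- Real polynomials in the `d` space variables. -/
abbrev Poly (d : ℕ) : Type := MvPolynomial (Fin d) ℝ

/-- The polynomials of total degree at most `l`. -/
abbrev polyLE (d l : ℕ) : Submodule ℝ (Poly d) := MvPolynomial.restrictTotalDegree (Fin d) ℝ l

/-- Value of a polynomial at a point. -/
def pev {d : ℕ} (P : Poly d) (x : Pt d) : ℝ := MvPolynomial.eval (fun i => x i) P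

/-! ### The continuous problem -/

/-- Smooth test functions with compact support inside `Ω`. -/
def IsTestFun {d : ℕ} (Ω : Set (Pt d)) (φ : Pt d → ℝ) : Prop :=
  ContDiff ℝ ∞ φ ∧ HasCompactSupport φ ∧ tsupport φ ⊆ Ω

/-- The classical partial derivative `∂_j φ`. -/
def partialD {d : ℕ} (j : Fin d) (φ : Pt d → ℝ) (x : Pt d) : ℝ :=
  fderiv ℝ φ x (EuclideanSpace.single j 1)

/-- `G` is the weak gradient of `u` on `Ω`; `G x j` is `∂_j u`. -/
def HasWeakGrad {d : ℕ} (Ω : Set (Pt d)) (u : Pt d → ℝ) (G : Pt d → Fin d → ℝ) : Prop :=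
  ∀ φ : Pt d → ℝ, IsTestFun Ω φ → ∀ j : Fin d,
    ∫ x in Ω, u x * partialD j φ x = - ∫ x in Ω, G x j * φ x

/-- `u ∈ H¹(Ω)`, with weak gradient `G`. -/
structure MemH1 {d : ℕ} (Ω : Set (Pt d)) (u : Pt d → ℝ) (G : Pt d → Fin d → ℝ) : Prop where
  memLp : MemLp u 2 (volume.restrict Ω)
  grad_memLp : ∀ j, MemLp (fun x => G x j) 2 (volume.restrict Ω)
  weakGrad : HasWeakGrad Ω u G

/-- `u ∈ H¹₀(Ω)`, the closure of the test functions in `H¹(Ω)`, with weak gradient `G`. -/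
structure MemH10 {d : ℕ} (Ω : Set (Pt d)) (u : Pt d → ℝ) (G : Pt d → Fin d → ℝ) : Prop
    extends MemH1 Ω u G where
  approx : ∃ φ : ℕ → Pt d → ℝ, (∀ n, IsTestFun Ω (φ n)) ∧
    Tendsto (fun n => eLpNorm (fun x => φ n x - u x) 2 (volume.restrict Ω)) atTop (𝓝 0) ∧
    ∀ j, Tendsto (fun n => eLpNorm (fun x => partialD j (φ n) x - G x j) 2 (volume.restrict Ω))
      atTop (𝓝 0)

/-- `q ∈ L²₀(Ω)`: square integrable with zero mean. -/
def MemL20 {d : ℕ} (Ω : Set (Pt d)) (q : Pt d → ℝ) : Prop :=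
  MemLp q 2 (volume.restrict Ω) ∧ ∫ x in Ω, q x = 0

/-- `(u, p)` is a weak solution in `[H¹₀(Ω)]^d × L²₀(Ω)` of the Stokes problem with viscosity `ν`
and body force `f`; `Du x i j` is the weak derivative `∂_j u_i`. -/
structure IsStokesSolution {d : ℕ} (Ω : Set (Pt d)) (ν : ℝ) (f : Pt d → Fin d → ℝ)
    (u : Pt d → Fin d → ℝ) (Du : Pt d → Fin d → Fin d → ℝ) (p : Pt d → ℝ) : Prop where
  vel_mem : ∀ i, MemH10 Ω (fun x => u x i) (fun x => Du x i)
  pres_mem : MemL20 Ω p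
  momentum : ∀ (v : Pt d → Fin d → ℝ) (Dv : Pt d → Fin d → Fin d → ℝ),
    (∀ i, MemH10 Ω (fun x => v x i) (fun x => Dv x i)) →
    ν * (∫ x in Ω, ∑ i, ∑ j, Du x i j * Dv x i j) - (∫ x in Ω, (∑ i, Dv x i i) * p x)
      = ∫ x in Ω, ∑ i, f x i * v x i
  mass : ∀ q : Pt d → ℝ, MemL20 Ω q → ∫ x in Ω, (∑ i, Du x i i) * q x = 0

/-! ### Polytopal meshes -/

/-- A polytope (polygon if `d = 2`, polyhedron if `d = 3`): a connected set that is the interior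
of a finite union of closed `d`-simplices. -/
def IsPolytope {d : ℕ} (X : Set (Pt d)) : Prop :=
  IsConnected X ∧ ∃ (n : ℕ) (S : Fin n → Affine.Simplex ℝ (Pt d) d),
    X = interior (⋃ i, (S i).closedInterior)

/-- The `(d-1)`-dimensional surface measure (Hausdorff measure, normalized so that it is the
Lebesgue measure on hyperplanes), restricted to `F`. -/
abbrev surf {d : ℕ} (F : Set (Pt d)) : Measure (Pt d) :=
  (Measure.euclideanHausdorffMeasure (d - 1) : Measure (Pt d)).restrict F

/-- `n` is the unit normal to the planar set `F` pointing out of `T`. -/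
structure IsOuterNormal {d : ℕ} (T F : Set (Pt d)) (n : Pt d) : Prop where
  unit : ‖n‖ = 1
  orthogonal : ∀ x ∈ F, ∀ y ∈ F, inner ℝ n (x - y) = 0
  outward : ∀ᵐ x ∂(surf F), ∀ᶠ t in 𝓝[>] (0 : ℝ), x - t • n ∈ T ∧ x + t • n ∉ T

/-- A polytopal mesh of `Ω`. Interfaces lie on the boundary of two distinct elements
`left F` and `right F` (in an arbitrary but fixed numbering); for boundary faces the two agree. -/
structure Mesh {d : ℕ} (Ω : Set (Pt d)) where
  nElem : ℕ
  nFace : ℕ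
  elem : Fin nElem → Set (Pt d)
  face : Fin nFace → Set (Pt d)
  left : Fin nFace → Fin nElem
  right : Fin nFace → Fin nElem
  /-- `normal T F` is the normal to `F` pointing out of `T`, for `F` on the boundary of `T`. -/
  normal : Fin nElem → Fin nFace → Pt d
  elem_polytope : ∀ T, IsPolytope (elem T)
  elem_disjoint : ∀ T T', T ≠ T' → Disjoint (elem T) (elem T')
  elem_cover : closure Ω = ⋃ T, closure (elem T)
  face_planar : ∀ F, ∃ (n : Pt d) (c : ℝ) (U : Set (Pt d)), n ≠ 0 ∧ IsOpen U ∧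
    face F = U ∩ {x | inner ℝ n x = c}
  face_pos : ∀ F, 0 < surf (face F) univ
  face_boundary_null : ∀ F, surf (closure (face F) \ face F) univ = 0
  face_disjoint : ∀ F F', F ≠ F' → Disjoint (face F) (face F')
  skeleton : ⋃ T, frontier (elem T) = ⋃ F, closure (face F)
  face_left : ∀ F, face F ⊆ frontier (elem (left F))
  face_right : ∀ F, face F ⊆ frontier (elem (right F))
  left_eq_right_iff : ∀ F, left F = right F ↔ face F ⊆ frontier Ω
  normal_spec : ∀ T F, face F ⊆ frontier (elem T) →
    IsOuterNormal (elem T) (face F) (normal T F)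

/-- A matching simplicial submesh: a conforming simplicial mesh of `Ω` such that every simplex lies
in exactly one mesh element and every (open) simplicial face is contained in or disjoint from every
mesh face. -/
structure Submesh {d : ℕ} [NeZero d] {Ω : Set (Pt d)} (M : Mesh Ω) where
  n : ℕ
  simplex : Fin n → Affine.Simplex ℝ (Pt d) d
  disjoint : ∀ S S', S ≠ S' → Disjoint (simplex S).interior (simplex S').interior
  cover : closure Ω = ⋃ S, (simplex S).closedInterior
  conforming : ∀ S S', S ≠ S' → ∃ I : Set (Fin (d + 1)),
    (simplex S).closedInterior ∩ (simplex S').closedInterior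
      = convexHull ℝ ((simplex S).points '' I)
  nested : ∀ S, ∃! T, (simplex S).interior ⊆ M.elem T
  face_compat : ∀ (S : Fin n) (i : Fin (d + 1)) (F : Fin M.nFace),
    Disjoint ((simplex S).faceOpposite i).interior (M.face F) ∨
      ((simplex S).faceOpposite i).interior ⊆ M.face F

/-- The mesh has regularity parameter `ρ`: some matching simplicial submesh is shape regular and
contact regular with parameter `ρ`. -/
def Mesh.IsRegular {d : ℕ} [NeZero d] {Ω : Set (Pt d)} (M : Mesh Ω) (ρ : ℝ) : Prop :=
  ∃ K : Submesh M,
    (∀ S, ρ * Metric.diam (K.simplex S).interior ≤ (K.simplex S).inradius) ∧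
    ∀ T S, (K.simplex S).interior ⊆ M.elem T →
      ρ * Metric.diam (M.elem T) ≤ Metric.diam (K.simplex S).interior

/-! ### The `L²`-orthogonal projector on polynomials -/

/-- `P` is an `L²(μ)`-orthogonal projection of `g` on the polynomials of degree at most `l`. -/
def IsL2Proj {d : ℕ} (μ : Measure (Pt d)) (l : ℕ) (g : Pt d → ℝ) (P : Poly d) : Prop :=
  P ∈ polyLE d l ∧ ∀ w ∈ polyLE d l, ∫ x, (pev P x - g x) * pev w x ∂μ = 0

/-- The `L²(μ)`-orthogonal projector `π^{0,l}`, used with `μ` the Lebesgue measure on an element or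
the surface measure on a face. The polynomial is determined as a function `μ`-almost everywhere. -/
def l2Proj {d : ℕ} (μ : Measure (Pt d)) (l : ℕ) (g : Pt d → ℝ) : Poly d :=
  Classical.epsilon (IsL2Proj μ l g)

/-! ### Auxiliary facts: the projector and the reconstructions below exist -/

theorem exists_riesz {V : Type*} [AddCommGroup V] [Module ℝ V] [FiniteDimensional ℝ V]
    (B : V → V → ℝ) (ℓ : V → ℝ) (hadd : ∀ a b c, B (a + b) c = B a c + B b c)
    (hsmul : ∀ (t : ℝ) a c, B (t • a) c = t * B a c) (hsymm : ∀ a b, B a b = B b a)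
    (ladd : ∀ a b, ℓ (a + b) = ℓ a + ℓ b) (lsmul : ∀ (t : ℝ) a, ℓ (t • a) = t * ℓ a)
    (hker : ∀ v, B v v = 0 → ℓ v = 0) : ∃ v, ∀ w, B v w = ℓ w := by
  let L : Module.Dual ℝ V := { toFun := ℓ, map_add' := ladd, map_smul' := by simpa using lsmul }
  let BB : V →ₗ[ℝ] Module.Dual ℝ V := LinearMap.mk₂ ℝ B hadd (by simpa using hsmul)
    (fun a b c => by rw [hsymm, hadd, hsymm b, hsymm c])
    (fun t a b => by rw [hsymm, hsmul, hsymm b]; rfl)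
  suffices h : L ∈ LinearMap.range BB by
    obtain ⟨v, hv⟩ := h
    exact ⟨v, fun w => congrArg (fun g : Module.Dual ℝ V => g w) hv⟩
  by_contra hL
  obtain ⟨g, hg, hle⟩ := Submodule.exists_le_ker_of_notMem hL
  obtain ⟨v, rfl⟩ := (Module.evalEquiv ℝ V).surjective g
  apply hg
  have h1 : B v v = 0 := hle ⟨v, rfl⟩
  exact hker v h1

theorem continuous_pev {d : ℕ} (P : Poly d) : Continuous (pev P) :=
  (MvPolynomial.continuous_eval P).comp (by fun_prop)

@[simp] theorem pev_add {d : ℕ} (P Q : Poly d) (x : Pt d) : pev (P + Q) x = pev P x + pev Q x := by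
  simp [pev]

@[simp] theorem pev_smul {d : ℕ} (t : ℝ) (P : Poly d) (x : Pt d) :
    pev (t • P) x = t * pev P x := by
  simp [pev]

theorem integrableOn_of_continuous {d : ℕ} (μ : Measure (Pt d)) (s : Set (Pt d))
    (hb : Bornology.IsBounded s) (hs : MeasurableSet s) (hμ : μ s ≠ ⊤) {g : Pt d → ℝ}
    (hg : Continuous g) : Integrable g (μ.restrict s) := by
  obtain ⟨C, hC⟩ := hb.isCompact_closure.exists_bound_of_continuousOn hg.continuousOn
  refine Measure.integrableOn_of_bounded (M := C) hμ hg.aestronglyMeasurable ?_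
  exact (ae_restrict_iff' hs).2 (Eventually.of_forall fun x hx => hC x (subset_closure hx))

theorem eq_zero_of_open {d : ℕ} {T : Set (Pt d)} (hT : IsOpen T) (hne : T.Nonempty) {P : Poly d}
    (h : ∫ x in T, pev P x ^ 2 = 0) (hi : IntegrableOn (fun x => pev P x ^ 2) T) : P = 0 := by
  have h1 : (fun x => pev P x ^ 2) =ᵐ[volume.restrict T] 0 :=
    (setIntegral_eq_zero_iff_of_nonneg_ae (Eventually.of_forall fun x => sq_nonneg _) hi).1 h
  have h2 : EqOn (fun x => pev P x ^ 2) 0 T :=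
    Measure.eqOn_open_of_ae_eq h1 hT ((continuous_pev P).pow 2).continuousOn continuousOn_const
  obtain ⟨x, hx⟩ := hne
  have h3 : IsOpen ((WithLp.toLp 2 : (Fin d → ℝ) → Pt d) ⁻¹' T) :=
    hT.preimage (PiLp.continuous_toLp 2 _)
  obtain ⟨ε, hε, hball⟩ := Metric.isOpen_iff.1 h3 (fun i => x i) (by simpa using hx)
  refine MvPolynomial.funext_set (fun i => Metric.ball (x i) ε)
    (fun i => infinite_of_mem_nhds (x i) (Metric.ball_mem_nhds _ hε)) fun y hy => ?_
  have h4 : WithLp.toLp 2 y ∈ T := hball (by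
    rw [ball_pi _ hε]; exact hy)
  have h5 := h2 h4
  simpa [pev] using h5

theorem IsPolytope.isOpen {d : ℕ} {X : Set (Pt d)} (h : IsPolytope X) : IsOpen X := by
  obtain ⟨-, n, S, rfl⟩ := h
  exact isOpen_interior

theorem IsPolytope.isBounded {d : ℕ} {X : Set (Pt d)} (h : IsPolytope X) :
    Bornology.IsBounded X := by
  obtain ⟨-, n, S, rfl⟩ := h
  refine Bornology.IsBounded.subset ?_ interior_subset
  refine Bornology.isBounded_iUnion.2 fun i => ?_
  rw [← Affine.Simplex.convexHull_eq_closedInterior]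
  exact (isBounded_convexHull).2 (finite_range _).isBounded

theorem volume_lt_top {d : ℕ} {X : Set (Pt d)} (h : IsPolytope X) : volume X ≠ ⊤ :=
  h.isBounded.measure_lt_top.ne

theorem surf_planar_lt_top {d : ℕ} {F : Set (Pt d)} (hF : Bornology.IsBounded F) {n : Pt d}
    {c : ℝ} (hn : n ≠ 0) (hFn : F ⊆ {x | inner ℝ n x = c}) :
    (Measure.euclideanHausdorffMeasure (d - 1) : Measure (Pt d)) F ≠ ⊤ := by
  rcases F.eq_empty_or_nonempty with rfl | ⟨p, hp⟩
  · simp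
  obtain ⟨m, rfl⟩ : ∃ m, d = m + 1 := by
    rcases d with _ | m
    · exact absurd (Subsingleton.elim n 0) hn
    · exact ⟨m, rfl⟩
  have : Fact (Module.finrank ℝ (Pt (m + 1)) = m + 1) := ⟨by simp⟩
  let K : Submodule ℝ (Pt (m + 1)) := (Submodule.span ℝ {n})ᗮ
  have hK : Module.finrank ℝ K = m := Submodule.finrank_orthogonal_span_singleton hn
  let ι : K → Pt (m + 1) := fun k => p + k
  have hι : Isometry ι := (isometry_add_left p).comp isometry_subtype_coe
  have hFr : F ⊆ range ι := fun x hx => by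
    refine ⟨⟨x - p, ?_⟩, by simp [ι]⟩
    rw [Submodule.mem_orthogonal_singleton_iff_inner_right, inner_sub_right,
      show inner ℝ n x = c from hFn hx, show inner ℝ n p = c from hFn hp, sub_self]
  have h1 := hι.euclideanHausdorffMeasure_preimage (d := m) F
  rw [inter_eq_left.2 hFr] at h1
  have h2 : (Measure.euclideanHausdorffMeasure m : Measure K) = volume := by
    rw [← InnerProductSpace.euclideanHausdorffMeasure_eq_volume (V := K), hK]
  rw [Nat.add_sub_cancel, ← h1, h2]
  exact (hι.antilipschitz.isBounded_preimage hF).measure_lt_top.ne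

section Discrete

variable {d : ℕ} {Ω : Set (Pt d)}

/-- The faces on the boundary of the element `T`. -/
def Mesh.facesOf (M : Mesh Ω) (T : Fin M.nElem) : Finset (Fin M.nFace) :=
  letI : DecidablePred fun F => M.face F ⊆ frontier (M.elem T) := Classical.decPred _
  Finset.univ.filter fun F => M.face F ⊆ frontier (M.elem T)

/-- The diameter of an element. -/
def Mesh.hT (M : Mesh Ω) (T : Fin M.nElem) : ℝ := Metric.diam (M.elem T)

/-- The diameter of a face. -/
def Mesh.hF (M : Mesh Ω) (F : Fin M.nFace) : ℝ := Metric.diam (M.face F)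

/-- Lebesgue measure on an element. -/
abbrev Mesh.vol (M : Mesh Ω) (T : Fin M.nElem) : Measure (Pt d) := volume.restrict (M.elem T)

/-- Surface measure on a face. -/
abbrev Mesh.area (M : Mesh Ω) (F : Fin M.nFace) : Measure (Pt d) := surf (M.face F)

/-- Discrete velocities: vector polynomials of degree at most `k` on every element and every face.
A face polynomial enters everything below only through its restriction to the face. -/
structure DiscVel (M : Mesh Ω) (k : ℕ) where
  cell : Fin M.nElem → Fin d → Poly d
  face : Fin M.nFace → Fin d → Poly d
  cell_mem : ∀ T i, cell T i ∈ polyLE d k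
  face_mem : ∀ F i, face F i ∈ polyLE d k

/-- The homogeneous Dirichlet condition: the face unknowns vanish on all boundary faces. -/
def DiscVel.VanishesOnBoundary {M : Mesh Ω} {k : ℕ} (v : DiscVel M k) : Prop :=
  ∀ F, M.face F ⊆ frontier Ω → ∀ i, ∀ x ∈ M.face F, pev (v.face F i) x = 0

/-- Discrete pressures: broken polynomials of degree at most `k` with zero mean on `Ω`. -/
structure DiscPres (M : Mesh Ω) (k : ℕ) where
  cell : Fin M.nElem → Poly d
  cell_mem : ∀ T, cell T ∈ polyLE d k
  mean_zero : ∑ T, ∫ x, pev (cell T) x ∂(M.vol T) = 0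

/-- Divergence of a vector polynomial. -/
def pdiv (v : Fin d → Poly d) : Poly d := ∑ i, MvPolynomial.pderiv i (v i)

/-- Pointwise Frobenius product `∇v : ∇w` of the gradients of vector polynomials. -/
def gradDot (v w : Fin d → Poly d) (x : Pt d) : ℝ :=
  ∑ i, ∑ j, pev (MvPolynomial.pderiv j (v i)) x * pev (MvPolynomial.pderiv j (w i)) x

/-- The component `((∇w) n)_i = ∑_j ∂_j w_i n_j` of the normal derivative of `w`. -/
def normalD (w : Fin d → Poly d) (n : Pt d) (i : Fin d) (x : Pt d) : ℝ :=
  ∑ j, pev (MvPolynomial.pderiv j (w i)) x * n j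

/-- `r` is the velocity reconstruction of `v` in `T`. -/
structure IsVelRec (M : Mesh Ω) {k : ℕ} (v : DiscVel M k) (T : Fin M.nElem)
    (r : Fin d → Poly d) : Prop where
  mem : ∀ i, r i ∈ polyLE d (k + 1)
  grad_eq : ∀ w : Fin d → Poly d, (∀ i, w i ∈ polyLE d (k + 1)) →
    ∫ x, gradDot r w x ∂(M.vol T) = (∫ x, gradDot (v.cell T) w x ∂(M.vol T))
      + ∑ F ∈ M.facesOf T, ∫ x, ∑ i, (pev (v.face F i) x - pev (v.cell T i) x)
          * normalD w (M.normal T F) i x ∂(M.area F)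
  mean_eq : ∀ i, ∫ x, pev (r i) x ∂(M.vol T) = ∫ x, pev (v.cell T i) x ∂(M.vol T)

/-- The local velocity reconstruction `r_T^{k+1}`. -/
def DiscVel.velRec {M : Mesh Ω} {k : ℕ} (v : DiscVel M k) (T : Fin M.nElem) : Fin d → Poly d :=
  Classical.epsilon (IsVelRec M v T)

/-- `D` is the divergence reconstruction of `v` in `T`. -/
def IsDivRec (M : Mesh Ω) {k : ℕ} (v : DiscVel M k) (T : Fin M.nElem) (D : Poly d) : Prop :=
  D ∈ polyLE d k ∧ ∀ q ∈ polyLE d k,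
    ∫ x, pev D x * pev q x ∂(M.vol T) = (∫ x, pev (pdiv (v.cell T)) x * pev q x ∂(M.vol T))
      + ∑ F ∈ M.facesOf T, ∫ x, ∑ i, (pev (v.face F i) x - pev (v.cell T i) x)
          * (pev q x * M.normal T F i) ∂(M.area F)

/-- The local divergence reconstruction `D_T^k`. -/
def DiscVel.divRec {M : Mesh Ω} {k : ℕ} (v : DiscVel M k) (T : Fin M.nElem) : Poly d :=
  Classical.epsilon (IsDivRec M v T)

theorem Mesh.integrable_vol (M : Mesh Ω) (T : Fin M.nElem) {g : Pt d → ℝ} (hg : Continuous g) :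
    Integrable g (M.vol T) :=
  integrableOn_of_continuous _ _ (M.elem_polytope T).isBounded
    (M.elem_polytope T).isOpen.measurableSet (volume_lt_top (M.elem_polytope T)) hg

theorem Mesh.integrable_area (M : Mesh Ω) (F : Fin M.nFace) {g : Pt d → ℝ} (hg : Continuous g) :
    Integrable g (M.area F) := by
  have hb : Bornology.IsBounded (M.face F) :=
    (M.elem_polytope (M.left F)).isBounded.closure.subset
      ((M.face_left F).trans frontier_subset_closure)
  obtain ⟨n, c, U, hn, hU, hF⟩ := M.face_planar F
  have hm : MeasurableSet (M.face F) := by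
    rw [hF]
    exact hU.measurableSet.inter
      (isClosed_eq (by fun_prop) continuous_const).measurableSet
  exact integrableOn_of_continuous _ _ hb hm
    (surf_planar_lt_top hb hn (hF.subset.trans inter_subset_right)) hg

theorem isL2Proj_l2Proj {μ : Measure (Pt d)}
    (hμ : ∀ g : Pt d → ℝ, Continuous g → Integrable g μ) (l : ℕ) {g : Pt d → ℝ}
    (hg : ∀ P : Poly d, Integrable (fun x => g x * pev P x) μ) :
    IsL2Proj μ l g (l2Proj μ l g) := by
  have hc : ∀ P Q : Poly d, Integrable (fun x => pev P x * pev Q x) μ := fun P Q =>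
    hμ _ ((continuous_pev P).mul (continuous_pev Q))
  apply Classical.epsilon_spec (p := IsL2Proj μ l g)
  obtain ⟨v, hv⟩ := exists_riesz (V := polyLE d l)
    (fun P Q => ∫ x, pev P.1 x * pev Q.1 x ∂μ) (fun Q => ∫ x, g x * pev Q.1 x ∂μ)
    (fun a b c => by
      rw [← integral_add (hc _ _) (hc _ _)]; congr 1; ext x; simp [add_mul])
    (fun t a c => by rw [← integral_const_mul]; congr 1; ext x; simp [mul_assoc])
    (fun a b => by congr 1; ext x; ring)
    (fun a b => by
      rw [← integral_add (hg _) (hg _)]; congr 1; ext x; simp [mul_add])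
    (fun t a => by rw [← integral_const_mul]; congr 1; ext x; simp; ring)
    (fun v h => by
      have h1 : (fun x => pev v.1 x * pev v.1 x) =ᵐ[μ] 0 :=
        (integral_eq_zero_iff_of_nonneg (fun x => mul_self_nonneg _) (hc _ _)).1 h
      refine integral_eq_zero_of_ae ?_
      filter_upwards [h1] with x hx
      have : pev v.1 x = 0 := mul_self_eq_zero.1 hx
      simp [this])
  refine ⟨v.1, v.2, fun w hw => ?_⟩
  have := hv ⟨w, hw⟩
  simp only [sub_mul]
  rw [integral_sub (hc _ _) (hg _)]
  exact sub_eq_zero.2 this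

theorem isDivRec_divRec {M : Mesh Ω} {k : ℕ} (v : DiscVel M k) (T : Fin M.nElem) :
    IsDivRec M v T (v.divRec T) := by
  apply Classical.epsilon_spec (p := IsDivRec M v T)
  have hc : ∀ P Q : Poly d, Integrable (fun x => pev P x * pev Q x) (M.vol T) := fun P Q =>
    M.integrable_vol T ((continuous_pev P).mul (continuous_pev Q))
  have hf : ∀ (F : Fin M.nFace) (Q : Poly d), Integrable (fun x =>
      ∑ i, (pev (v.face F i) x - pev (v.cell T i) x) * (pev Q x * M.normal T F i)) (M.area F) :=
    fun F Q => M.integrable_area F (continuous_finsetSum _ fun i _ =>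
      ((continuous_pev _).sub (continuous_pev _)).mul ((continuous_pev _).mul continuous_const))
  obtain ⟨D, hD⟩ := exists_riesz (V := polyLE d k)
    (fun P Q => ∫ x, pev P.1 x * pev Q.1 x ∂(M.vol T))
    (fun q => (∫ x, pev (pdiv (v.cell T)) x * pev q.1 x ∂(M.vol T))
      + ∑ F ∈ M.facesOf T, ∫ x, ∑ i, (pev (v.face F i) x - pev (v.cell T i) x)
          * (pev q.1 x * M.normal T F i) ∂(M.area F))
    (fun a b c => by
      rw [← integral_add (hc _ _) (hc _ _)]; congr 1; ext x; simp [add_mul])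
    (fun t a c => by rw [← integral_const_mul]; congr 1; ext x; simp [mul_assoc])
    (fun a b => by congr 1; ext x; ring)
    (fun a b => by
      rw [add_add_add_comm, ← integral_add (hc _ _) (hc _ _), ← Finset.sum_add_distrib]
      congr 1
      · congr 1; ext x; simp [mul_add]
      · refine Finset.sum_congr rfl fun F _ => ?_
        rw [← integral_add (hf _ _) (hf _ _)]
        congr 1; ext x; rw [← Finset.sum_add_distrib]
        refine Finset.sum_congr rfl fun i _ => ?_
        simp; ring)
    (fun t a => by
      rw [mul_add, ← integral_const_mul, Finset.mul_sum]
      congr 1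
      · congr 1; ext x; simp; ring
      · refine Finset.sum_congr rfl fun F _ => ?_
        rw [← integral_const_mul]
        congr 1; ext x; rw [Finset.mul_sum]
        refine Finset.sum_congr rfl fun i _ => ?_
        simp; ring)
    (fun q h => by
      have hq : q.1 = 0 := eq_zero_of_open (M.elem_polytope T).isOpen
        (M.elem_polytope T).1.nonempty (by simpa only [sq] using h)
        (by simp only [sq]; exact hc q.1 q.1)
      simp [hq, pev])
  exact ⟨D.1, D.2, fun q hq => hD ⟨q, hq⟩⟩

theorem isVelRec_velRec {M : Mesh Ω} {k : ℕ} (v : DiscVel M k) (T : Fin M.nElem) :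
    IsVelRec M v T (v.velRec T) := by
  apply Classical.epsilon_spec (p := IsVelRec M v T)
  have hgc : ∀ v w : Fin d → Poly d, Continuous (gradDot v w) := fun v w =>
    continuous_finsetSum _ fun i _ => continuous_finsetSum _ fun j _ =>
      (continuous_pev _).mul (continuous_pev _)
  have hc : ∀ v w : Fin d → Poly d, Integrable (gradDot v w) (M.vol T) := fun v w =>
    M.integrable_vol T (hgc v w)
  have hf : ∀ (F : Fin M.nFace) (w : Fin d → Poly d), Integrable (fun x =>
      ∑ i, (pev (v.face F i) x - pev (v.cell T i) x) * normalD w (M.normal T F) i x) (M.area F) :=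
    fun F w => M.integrable_area F (continuous_finsetSum _ fun i _ =>
      ((continuous_pev _).sub (continuous_pev _)).mul
        (continuous_finsetSum _ fun j _ => (continuous_pev _).mul continuous_const))
  have gadd : ∀ (a b c : Fin d → Poly d) x, gradDot c (a + b) x = gradDot c a x + gradDot c b x := by
    intro a b c x
    simp [gradDot, mul_add, Finset.sum_add_distrib]
  have gsmul : ∀ (t : ℝ) (a c : Fin d → Poly d) x, gradDot c (t • a) x = t * gradDot c a x := by
    intro t a c x
    simp only [gradDot, Finset.mul_sum, Pi.smul_apply]
    exact Finset.sum_congr rfl fun i _ => Finset.sum_congr rfl fun j _ => by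
      rw [Derivation.map_smul, pev_smul]; ring
  have gsymm : ∀ (a b : Fin d → Poly d) x, gradDot a b x = gradDot b a x := by
    intro a b x
    simp only [gradDot]
    exact Finset.sum_congr rfl fun i _ => Finset.sum_congr rfl fun j _ => by ring
  have nadd : ∀ (a b : Fin d → Poly d) n i x,
      normalD (a + b) n i x = normalD a n i x + normalD b n i x := by
    intro a b n i x
    simp [normalD, add_mul, Finset.sum_add_distrib]
  have nsmul : ∀ (t : ℝ) (a : Fin d → Poly d) n i x,
      normalD (t • a) n i x = t * normalD a n i x := by
    intro t a n i x
    simp [normalD, Finset.mul_sum, mul_assoc]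
  let c : (Fin d → polyLE d (k + 1)) → Fin d → Poly d := fun a i => (a i).1
  have cadd : ∀ a b, c (a + b) = c a + c b := fun a b => rfl
  have csmul : ∀ (t : ℝ) a, c (t • a) = t • c a := fun t a => rfl
  obtain ⟨R, hR⟩ := exists_riesz (V := Fin d → polyLE d (k + 1))
    (fun a b => ∫ x, gradDot (c a) (c b) x ∂(M.vol T))
    (fun w => (∫ x, gradDot (v.cell T) (c w) x ∂(M.vol T))
      + ∑ F ∈ M.facesOf T, ∫ x, ∑ i, (pev (v.face F i) x - pev (v.cell T i) x)
          * normalD (c w) (M.normal T F) i x ∂(M.area F))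
    (fun a b e => by
      rw [← integral_add (hc _ _) (hc _ _)]; congr 1; ext x
      rw [gsymm, cadd, gadd, gsymm _ (c a), gsymm _ (c b)])
    (fun t a e => by
      rw [← integral_const_mul]; congr 1; ext x
      rw [gsymm, csmul, gsmul, gsymm])
    (fun a b => by congr 1; ext x; exact gsymm _ _ x)
    (fun a b => by
      rw [add_add_add_comm, ← integral_add (hc _ _) (hc _ _), ← Finset.sum_add_distrib]
      congr 1
      · congr 1; ext x; rw [cadd, gadd]
      · refine Finset.sum_congr rfl fun F _ => ?_
        rw [← integral_add (hf _ _) (hf _ _)]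
        congr 1; ext x; rw [← Finset.sum_add_distrib]
        refine Finset.sum_congr rfl fun i _ => ?_
        rw [cadd, nadd]; ring)
    (fun t a => by
      rw [mul_add, ← integral_const_mul, Finset.mul_sum]
      congr 1
      · congr 1; ext x; rw [csmul, gsmul]
      · refine Finset.sum_congr rfl fun F _ => ?_
        rw [← integral_const_mul]
        congr 1; ext x; rw [Finset.mul_sum]
        refine Finset.sum_congr rfl fun i _ => ?_
        rw [csmul, nsmul]; ring)
    (fun w h => by
      have hi : ∀ P : Poly d, IntegrableOn (fun x => pev P x ^ 2) (M.elem T) := fun P =>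
        M.integrable_vol T ((continuous_pev P).pow 2)
      have h0 : ∑ i, ∑ j, ∫ x, pev (MvPolynomial.pderiv j (c w i)) x ^ 2 ∂(M.vol T) = 0 := by
        rw [← h]
        simp only [gradDot, ← sq]
        rw [integral_finsetSum _ fun i _ => integrable_finsetSum _ fun j _ => hi _]
        refine Finset.sum_congr rfl fun i _ => ?_
        rw [integral_finsetSum _ fun j _ => hi _]
      have hz : ∀ i j, MvPolynomial.pderiv j (c w i) = 0 := by
        intro i j
        have hn : ∀ i j, 0 ≤ ∫ x, pev (MvPolynomial.pderiv j (c w i)) x ^ 2 ∂(M.vol T) :=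
          fun i j => integral_nonneg fun x => sq_nonneg _
        have h1 := (Finset.sum_eq_zero_iff_of_nonneg
          (fun i _ => Finset.sum_nonneg fun j _ => hn i j)).1 h0 i (Finset.mem_univ i)
        have h2 := (Finset.sum_eq_zero_iff_of_nonneg (fun j _ => hn i j)).1 h1 j
          (Finset.mem_univ j)
        exact eq_zero_of_open (M.elem_polytope T).isOpen (M.elem_polytope T).1.nonempty h2 (hi _)
      simp [gradDot, normalD, hz, pev])
  have hvol : (volume (M.elem T)).toReal ≠ 0 :=
    (ENNReal.toReal_pos ((M.elem_polytope T).isOpen.measure_pos _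
      (M.elem_polytope T).1.nonempty).ne' (volume_lt_top (M.elem_polytope T))).ne'
  let m : Fin d → ℝ := fun i => ((volume (M.elem T)).toReal)⁻¹ *
    ((∫ x, pev (v.cell T i) x ∂(M.vol T)) - ∫ x, pev (c R i) x ∂(M.vol T))
  refine ⟨fun i => c R i + MvPolynomial.C (m i), fun i => ?_, fun w hw => ?_, fun i => ?_⟩
  · refine Submodule.add_mem _ (R i).2 ?_
    rw [MvPolynomial.mem_restrictTotalDegree]; simp
  · rw [← hR fun i => ⟨w i, hw i⟩]
    congr 1; ext x; simp [gradDot, c]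
  · have h1 : ∀ x, pev (c R i + MvPolynomial.C (m i)) x = pev (c R i) x + m i := by
      intro x; simp [pev]
    simp only [h1]
    rw [integral_add (M.integrable_vol T (continuous_pev _)) (M.integrable_vol T continuous_const),
      integral_const]
    simp only [m, smul_eq_mul, Measure.real, Mesh.vol, Measure.restrict_apply_univ]
    field_simp
    ring
/-- `δ_T^k v = π_T^{0,k} (r_T^{k+1} v - v_T)`. -/
def DiscVel.deltaT {M : Mesh Ω} {k : ℕ} (v : DiscVel M k) (T : Fin M.nElem) : Fin d → Poly d :=
  fun i => l2Proj (M.vol T) k fun x => pev (v.velRec T i) x - pev (v.cell T i) x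

/-- `δ_{TF}^k v = π_F^{0,k} (r_T^{k+1} v - v_F)`. -/
def DiscVel.deltaTF {M : Mesh Ω} {k : ℕ} (v : DiscVel M k) (T : Fin M.nElem) (F : Fin M.nFace) :
    Fin d → Poly d :=
  fun i => l2Proj (M.area F) k fun x => pev (v.velRec T i) x - pev (v.face F i) x

/-- The local stabilization form `s_T`. -/
def stab {M : Mesh Ω} {k : ℕ} (w v : DiscVel M k) (T : Fin M.nElem) : ℝ :=
  (M.hT T ^ 2)⁻¹ * (∫ x, ∑ i, pev (w.deltaT T i) x * pev (v.deltaT T i) x ∂(M.vol T))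
    + ∑ F ∈ M.facesOf T, (M.hF F)⁻¹ *
        ∫ x, ∑ i, pev (w.deltaTF T F i) x * pev (v.deltaTF T F i) x ∂(M.area F)

/-- The viscous form `a_h`. -/
def viscForm {M : Mesh Ω} {k : ℕ} (w v : DiscVel M k) : ℝ :=
  ∑ T, ((∫ x, gradDot (w.velRec T) (v.velRec T) x ∂(M.vol T)) + stab w v T)

/-- The velocity-pressure coupling form `b_h`. -/
def couplForm {M : Mesh Ω} {k : ℕ} (v : DiscVel M k) (q : DiscPres M k) : ℝ :=
  - ∑ T, ∫ x, pev (v.divRec T) x * pev (q.cell T) x ∂(M.vol T)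

/-- `(uh, ph)` solves the hybrid high-order scheme for the Stokes problem. -/
structure IsHHOSolution {M : Mesh Ω} {k : ℕ} (ν : ℝ) (f : Pt d → Fin d → ℝ)
    (uh : DiscVel M k) (ph : DiscPres M k) : Prop where
  boundary : uh.VanishesOnBoundary
  momentum : ∀ v : DiscVel M k, v.VanishesOnBoundary →
    ν * viscForm uh v + couplForm v ph = ∑ T, ∫ x, ∑ i, f x i * pev (v.cell T i) x ∂(M.vol T)
  mass : ∀ q : DiscPres M k, - couplForm uh q = 0

/-! ### Errors, estimator and data oscillation -/

/-- The squared velocity error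
`∑_T (ν ‖∇u - ∇ r_T uh‖²_T + ν s_T(uh, uh))`, where `Du x i j` is `∂_j u_i`. -/
def errVelSq {M : Mesh Ω} {k : ℕ} (ν : ℝ) (Du : Pt d → Fin d → Fin d → ℝ) (uh : DiscVel M k) : ℝ :=
  ∑ T, (ν * (∫ x, ∑ i, ∑ j,
      (Du x i j - pev (MvPolynomial.pderiv j (uh.velRec T i)) x) ^ 2 ∂(M.vol T))
    + ν * stab uh uh T)

/-- The squared pressure error `∑_T ν⁻¹ ‖p - p_T‖²_T`. -/
def errPresSq {M : Mesh Ω} {k : ℕ} (ν : ℝ) (p : Pt d → ℝ) (ph : DiscPres M k) : ℝ :=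
  ∑ T, ν⁻¹ * ∫ x, (p x - pev (ph.cell T) x) ^ 2 ∂(M.vol T)

/-- Components of the jump of a broken vector polynomial across a face; on a boundary face it is
the trace. -/
def jump (M : Mesh Ω) (v : Fin M.nElem → Fin d → Poly d) (F : Fin M.nFace) (i : Fin d)
    (x : Pt d) : ℝ :=
  letI : Decidable (M.face F ⊆ frontier Ω) := Classical.dec _
  if M.face F ⊆ frontier Ω then pev (v (M.left F) i) x
  else pev (v (M.left F) i) x - pev (v (M.right F) i) x

/-- The squared divergence part `η_{d,T}²` of the estimator. -/
def etaDivSq {M : Mesh Ω} {k : ℕ} (ν : ℝ) (uh : DiscVel M k) (T : Fin M.nElem) : ℝ :=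
  ν * ∫ x, pev (pdiv (uh.velRec T)) x ^ 2 ∂(M.vol T)

/-- The squared stabilization part `η_{s,T}²` of the estimator. -/
def etaStabSq {M : Mesh Ω} {k : ℕ} (ν : ℝ) (uh : DiscVel M k) (T : Fin M.nElem) : ℝ :=
  ν * stab uh uh T

/-- The squared jump part `η_{J,T}²` of the estimator. -/
def etaJumpSq {M : Mesh Ω} {k : ℕ} (ν : ℝ) (uh : DiscVel M k) (T : Fin M.nElem) : ℝ :=
  ν * ∑ F ∈ M.facesOf T, (M.hF F)⁻¹ * ∫ x, ∑ i, jump M uh.velRec F i x ^ 2 ∂(M.area F)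

/-- The squared estimator `η_h² = η_{d,h}² + η_{s,h}² + η_{J,h}²`. -/
def etaSq {M : Mesh Ω} {k : ℕ} (ν : ℝ) (uh : DiscVel M k) : ℝ :=
  (∑ T, etaDivSq ν uh T) + (∑ T, etaStabSq ν uh T) + ∑ T, etaJumpSq ν uh T

/-- The squared data oscillation `∑_T ν⁻¹ h_T² ‖f - π_T^{0,k} f‖²_T`. -/
def oscSq (M : Mesh Ω) (k : ℕ) (ν : ℝ) (f : Pt d → Fin d → ℝ) : ℝ :=
  ∑ T, ν⁻¹ * M.hT T ^ 2 *
    ∫ x, ∑ i, (f x i - pev (l2Proj (M.vol T) k fun y => f y i) x) ^ 2 ∂(M.vol T)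

end Discrete

end StokesHHO

end

noncomputable section

namespace StokesHHO

set_option linter.unusedSectionVars false

/-! ### Slicing Lebesgue measure by parallel hyperplanes -/

/-! Each of the three parts of the estimator is controlled by the velocity error alone; the pressure
error and the oscillation are nonnegative and only enlarge the right-hand side. The stabilization
part occurs literally in the error. For the divergence part, `div u = 0` almost everywhere, so the
divergence of the reconstruction is minus the trace of `∇u - ∇r_T u_T`, and Cauchy-Schwarz costs a
factor `d` (`etaDivSq_le`).

The work is in the jumps. On an interface the face unknown cancels, so the projection of the jump on
polynomials of degree `k` is the difference of the two `δ_TF`; on a boundary face the unknown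
vanishes and the projection is the single `δ_TF`. This component is bounded by the stabilization.
What remains is the distance of the jump to its projection, hence at most its distance to any
constant. To avoid traces of Sobolev functions, each component of `u` is replaced by a test function
`φ` close to it in the `H¹` seminorm. Since `φ` is single-valued across interfaces and zero on the
boundary, it may be inserted in the jump, and the jump minus `a_left - a_right` splits into terms
`r_T - φ - a_T`, one for each side (`integral_jump_sq_le`). An element inequality `∑_F h_F⁻¹ ‖w -
a‖_F² ≤ C ‖∇w‖_T²` for a suitable constant `a` finishes the argument after `φ` tends to `u`
(`sum_jump_le`).

The element inequality `exists_sum_faces_le` needs a constant depending only on shape regularity, so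
it is proved constructively. On one simplex, `|w(x) - w(y)|²` is integrated over `x` in a facet and
`y` in an interior ball, with `w(x) - w(y)` written as a line integral of the gradient; a good `y`
then supplies the constant `w(y)`. An element is connected through facets of its submesh
(`Submesh.exists_facet_subset`), the constants of two simplices sharing a facet are close, and the
number of simplices in an element is bounded by comparing volumes. Chaining along a path replaces
all these constants by one. -/

theorem lintegral_comp_smul_add {V : Type*} [NormedAddCommGroup V] [InnerProductSpace ℝ V]
    [FiniteDimensional ℝ V] [MeasurableSpace V] [BorelSpace V] {g : V → ℝ≥0∞} (hg : Measurable g)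
    {r : ℝ} (hr : r ≠ 0) (b : V) :
    ∫⁻ z, g (r • z + b) = ENNReal.ofReal |(r ^ Module.finrank ℝ V)⁻¹| * ∫⁻ z, g z := by
  have h1 : ∫⁻ z, g (r • z + b) = ∫⁻ z, g (z + b) ∂(Measure.map (r • ·) (volume : Measure V)) := by
    rw [lintegral_map (by fun_prop) (by fun_prop)]
  rw [h1, Measure.map_addHaar_smul _ hr, lintegral_smul_measure, lintegral_add_right_eq_self]
  rfl

section Slices

variable {d : ℕ}

/-- The hyperplane through the origin with normal `n`. -/
abbrev hyp (n : Pt d) : Submodule ℝ (Pt d) := (ℝ ∙ n)ᗮ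

theorem finrank_hyp {n : Pt d} (hn : ‖n‖ = 1) : Module.finrank ℝ (hyp n) = d - 1 := by
  have h0 : n ≠ 0 := by rintro rfl; simp at hn
  have h := Submodule.finrank_add_finrank_orthogonal (ℝ ∙ n)
  rw [finrank_span_singleton h0, finrank_euclideanSpace_fin] at h
  change Module.finrank ℝ ((ℝ ∙ n)ᗮ : Submodule ℝ (Pt d)) = d - 1
  omega

theorem measurePreserving_slice {n : Pt d} (hn : ‖n‖ = 1) :
    MeasurePreserving (fun q : ℝ × hyp n => q.1 • n + (q.2 : Pt d)) := by
  have h1 := ((ℝ ∙ n).measurePreserving_measurableEquivProd (0 : Pt d)).symm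
  rw [InnerProductSpace.euclideanHausdorffMeasure_eq_volume] at h1
  have h2 := ((LinearIsometryEquiv.toSpanUnitSingleton (𝕜 := ℝ) n hn).measurePreserving).prod
    (MeasurePreserving.id (volume : Measure (hyp n)))
  have h3 := h1.comp h2
  rw [← Measure.volume_eq_prod] at h3
  convert h3 using 1
  ext q
  simp

theorem lintegral_eq_slices {n : Pt d} (hn : ‖n‖ = 1) {f : Pt d → ℝ≥0∞} (hf : Measurable f) :
    ∫⁻ x, f x = ∫⁻ s : ℝ, ∫⁻ z : hyp n, f (s • n + (z : Pt d)) := by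
  rw [← (measurePreserving_slice hn).lintegral_comp hf, Measure.volume_eq_prod,
    lintegral_prod (fun q : ℝ × hyp n => f (q.1 • n + (q.2 : Pt d)))
      (hf.comp (measurePreserving_slice hn).measurable).aemeasurable]

theorem isometry_hyp (n : Pt d) (c : ℝ) : Isometry fun z : hyp n => c • n + (z : Pt d) :=
  (isometry_add_left _).comp isometry_subtype_coe

theorem map_hyp_eq {n : Pt d} (hn : ‖n‖ = 1) (c : ℝ) :
    Measure.map (fun z : hyp n => c • n + (z : Pt d)) volume = surf {x | inner ℝ n x = c} := by
  have h := (isometry_hyp n c).map_euclideanHausdorffMeasure (d := d - 1)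
  have h2 : (Measure.euclideanHausdorffMeasure (d - 1) : Measure (hyp n)) = volume := by
    rw [← InnerProductSpace.euclideanHausdorffMeasure_eq_volume (V := hyp n), finrank_hyp hn]
  rw [h2] at h
  rw [h]
  congr 1
  ext x
  simp only [mem_range, mem_ofPred_eq]
  constructor
  · rintro ⟨z, rfl⟩
    have hz := Submodule.mem_orthogonal_singleton_iff_inner_right.1 z.2
    rw [inner_add_right, inner_smul_right, hz, real_inner_self_eq_norm_sq, hn]; simp
  · intro hx
    refine ⟨⟨x - c • n, ?_⟩, by simp⟩
    rw [Submodule.mem_orthogonal_singleton_iff_inner_right, inner_sub_right, inner_smul_right,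
      real_inner_self_eq_norm_sq, hn, hx]; simp

theorem lintegral_surf_hyp {n : Pt d} (hn : ‖n‖ = 1) (c : ℝ) {g : Pt d → ℝ≥0∞}
    (hg : Measurable g) :
    ∫⁻ x, g x ∂(surf {x | inner ℝ n x = c}) = ∫⁻ z : hyp n, g (c • n + (z : Pt d)) := by
  rw [← map_hyp_eq hn, lintegral_map hg (by fun_prop)]

theorem surf_closedBall {n : Pt d} (hn : ‖n‖ = 1) {c : ℝ} {x : Pt d} (hx : inner ℝ n x = c)
    {R : ℝ} (hR : 0 ≤ R) :
    surf {x | inner ℝ n x = c} (Metric.closedBall x R)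
      = ENNReal.ofReal (R ^ (d - 1)) * volume (Metric.ball (0 : hyp n) 1) := by
  obtain ⟨z, rfl⟩ : ∃ z : hyp n, x = c • n + (z : Pt d) := by
    refine ⟨⟨x - c • n, ?_⟩, by simp⟩
    rw [Submodule.mem_orthogonal_singleton_iff_inner_right, inner_sub_right, inner_smul_right,
      real_inner_self_eq_norm_sq, hn, hx]; simp
  rw [← map_hyp_eq hn, Measure.map_apply (by fun_prop) Metric.isClosed_closedBall.measurableSet,
    (isometry_hyp n c).preimage_closedBall z, Measure.addHaar_closedBall _ _ hR, finrank_hyp hn]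

/-- For fixed `t`, the map `x ↦ x + t (y - x)` is a homothety of ratio `1 - t ≥ 1/2` from the
hyperplane at level `c` onto a parallel one, and changes `(d-1)`-dimensional measure by at most
`2^(d-1)`. As `t` varies, the image hyperplanes sweep space with speed `|⟨n, y⟩ - c| ≥ δ`, which
gives the factor `1/δ`. -/
theorem lintegral_cone_le {n : Pt d} (hn : ‖n‖ = 1) {c δ : ℝ} (hδ : 0 < δ) {y : Pt d}
    (hy : δ ≤ |inner ℝ n y - c|) {f : Pt d → ℝ≥0∞} (hf : Measurable f) :
    ∫⁻ t in Icc (0 : ℝ) (1 / 2), ∫⁻ x, f (x + t • (y - x)) ∂(surf {x | inner ℝ n x = c})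
      ≤ ENNReal.ofReal (2 ^ (d - 1) / δ) * ∫⁻ x, f x := by
  set e := inner ℝ n y - c with he
  have he0 : e ≠ 0 := by
    intro h; rw [h, abs_zero] at hy; linarith
  obtain ⟨z0, hz0⟩ : ∃ z : hyp n, y = (c + e) • n + (z : Pt d) := by
    refine ⟨⟨y - (c + e) • n, ?_⟩, by simp⟩
    rw [Submodule.mem_orthogonal_singleton_iff_inner_right, inner_sub_right, inner_smul_right,
      real_inner_self_eq_norm_sq, hn, he]; simp
  let G : ℝ → ℝ≥0∞ := fun s => ∫⁻ z : hyp n, f (s • n + (z : Pt d))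
  have hG : Measurable G := by
    apply Measurable.lintegral_prod_right' (f := fun q : ℝ × hyp n => f (q.1 • n + (q.2 : Pt d)))
    exact hf.comp (measurePreserving_slice hn).measurable
  have h1 : ∀ t ∈ Icc (0 : ℝ) (1 / 2),
      ∫⁻ x, f (x + t • (y - x)) ∂(surf {x | inner ℝ n x = c})
        ≤ ENNReal.ofReal (2 ^ (d - 1)) * G (e • t + c) := by
    intro t ht
    rw [lintegral_surf_hyp hn c (g := fun x => f (x + t • (y - x))) (by fun_prop)]
    have h2 : ∀ z : hyp n, f (c • n + (z : Pt d) + t • (y - (c • n + (z : Pt d))))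
        = (fun z : hyp n => f ((e • t + c) • n + (z : Pt d))) ((1 - t) • z + t • z0) := by
      intro z
      simp only [hz0, Submodule.coe_add, Submodule.coe_smul]
      congr 1
      module
    simp only [h2]
    have ht1 : (1 - t) ≠ 0 := by have := ht.2; intro h; linarith
    rw [lintegral_comp_smul_add (g := fun z : hyp n => f ((e • t + c) • n + (z : Pt d)))
      (by fun_prop) ht1, finrank_hyp hn]
    gcongr
    rw [abs_of_nonneg (by have := ht.2; have : 0 ≤ 1 - t := by linarith
                          positivity), ← inv_pow]
    have h3 : (1 - t)⁻¹ ≤ 2 := by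
      rw [inv_le_comm₀ (by have := ht.2; linarith) (by norm_num)]
      have := ht.2; linarith
    gcongr
    rw [inv_nonneg]; have := ht.2; linarith
  calc _ ≤ ∫⁻ t in Icc (0 : ℝ) (1 / 2), ENNReal.ofReal (2 ^ (d - 1)) * G (e • t + c) :=
        setLIntegral_mono' measurableSet_Icc h1
    _ ≤ ∫⁻ t, ENNReal.ofReal (2 ^ (d - 1)) * G (e • t + c) := setLIntegral_le_lintegral _ _
    _ = ENNReal.ofReal (2 ^ (d - 1)) * (ENNReal.ofReal |e⁻¹| * ∫⁻ s, G s) := by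
        rw [lintegral_const_mul _ (by fun_prop), lintegral_comp_smul_add hG he0]
        simp
    _ ≤ _ := by
        rw [lintegral_eq_slices hn hf, ← mul_assoc, ← ENNReal.ofReal_mul (by positivity)]
        gcongr
        rw [div_eq_mul_inv, abs_inv]
        gcongr

end Slices

/-! ### A trace inequality on convex sets -/

theorem sq_lintegral_le {g : ℝ → ℝ≥0∞} (hg : Measurable g) :
    (∫⁻ t in Icc (0 : ℝ) 1, g t) ^ 2 ≤ ∫⁻ t in Icc (0 : ℝ) 1, g t ^ 2 := by
  have h := ENNReal.lintegral_mul_le_Lp_mul_Lq (volume.restrict (Icc (0 : ℝ) 1))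
    Real.HolderConjugate.two_two hg.aemeasurable (aemeasurable_const (b := (1 : ℝ≥0∞)))
  simp only [Pi.mul_apply, mul_one, ENNReal.one_rpow, lintegral_const,
    Measure.restrict_apply_univ, Real.volume_Icc, sub_zero, ENNReal.ofReal_one] at h
  calc _ ≤ ((∫⁻ t in Icc (0 : ℝ) 1, g t ^ (2 : ℝ)) ^ (1 / 2 : ℝ)) ^ 2 := by gcongr
    _ = _ := by
      rw [← ENNReal.rpow_natCast, ← ENNReal.rpow_mul]
      norm_num

/-- Fundamental theorem of calculus along the segment, then Cauchy-Schwarz on the unit interval. -/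
theorem enorm_sub_sq_le {V : Type*} [NormedAddCommGroup V] [NormedSpace ℝ V] {w : V → ℝ}
    (hw : ContDiff ℝ 1 w) (x y : V) :
    ‖w y - w x‖ₑ ^ 2
      ≤ ‖y - x‖ₑ ^ 2 * ∫⁻ t in Icc (0 : ℝ) 1, ‖fderiv ℝ w (x + t • (y - x))‖ₑ ^ 2 := by
  have hc : Continuous (fderiv ℝ w) := hw.continuous_fderiv (by norm_num)
  have hl : Continuous fun t : ℝ => x + t • (y - x) := by fun_prop
  have h1 : ∀ t : ℝ, HasDerivAt (fun t : ℝ => w (x + t • (y - x)))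
      (fderiv ℝ w (x + t • (y - x)) (y - x)) t := by
    intro t
    have h2 : HasDerivAt (fun t : ℝ => x + t • (y - x)) (y - x) t := by
      simpa using ((hasDerivAt_id t).smul_const (y - x)).const_add x
    exact ((hw.differentiable (by norm_num)) _).hasFDerivAt.comp_hasDerivAt t h2
  have h2 := intervalIntegral.integral_eq_sub_of_hasDerivAt (a := 0) (b := 1)
    (fun t _ => h1 t) (((hc.comp hl).clm_apply continuous_const).intervalIntegrable _ _)
  simp only [one_smul, zero_smul, add_zero, add_sub_cancel] at h2
  rw [← h2, intervalIntegral.integral_of_le zero_le_one]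
  have hm : Measurable fun t : ℝ => ‖fderiv ℝ w (x + t • (y - x))‖ₑ := (hc.comp hl).enorm.measurable
  calc _ ≤ (∫⁻ t in Ioc (0 : ℝ) 1, ‖fderiv ℝ w (x + t • (y - x)) (y - x)‖ₑ) ^ 2 := by
        gcongr; exact enorm_integral_le_lintegral_enorm _
    _ ≤ (∫⁻ t in Icc (0 : ℝ) 1, ‖fderiv ℝ w (x + t • (y - x))‖ₑ * ‖y - x‖ₑ) ^ 2 := by
        gcongr
        · exact Ioc_subset_Icc_self
        · exact ContinuousLinearMap.le_opENorm _ _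
    _ = ‖y - x‖ₑ ^ 2 * (∫⁻ t in Icc (0 : ℝ) 1, ‖fderiv ℝ w (x + t • (y - x))‖ₑ) ^ 2 := by
        rw [lintegral_mul_const _ hm]; ring
    _ ≤ _ := by gcongr; exact sq_lintegral_le hm

/-- Needed for Tonelli: Hausdorff measure of dimension `d - 1` is not σ-finite on the whole space,
but on a hyperplane it is an image of Lebesgue measure. -/
theorem sFinite_surf {d : ℕ} {n : Pt d} (hn : ‖n‖ = 1) {c : ℝ} {σ : Set (Pt d)}
    (hσ : σ ⊆ {x | inner ℝ n x = c}) : SFinite (surf σ) := by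
  have h : SFinite (surf {x : Pt d | inner ℝ n x = c}) := by
    rw [← map_hyp_eq hn]; infer_instance
  rw [surf, ← Measure.restrict_restrict_of_subset hσ]
  infer_instance

/-- The gradient is integrated along each segment from `x` to `y`, cut at its midpoint. On the half
near `x` the point `y` is frozen and `x` sweeps a cone (`lintegral_cone_le`); on the half near `y`
the point `x` is frozen and `y ↦ x + t (y - x)` is a homothety of ratio at least `1/2`. Neither
change of variables degenerates on its half. -/
theorem lintegral_pairs_le {d : ℕ} {n : Pt d} (hn : ‖n‖ = 1) {c δ h : ℝ} (hδ : 0 < δ)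
    {S B σ : Set (Pt d)} (hS : Convex ℝ S) (hSm : MeasurableSet S) (hBS : B ⊆ S)
    (hBm : MeasurableSet B) (hBn : ∀ y ∈ B, δ ≤ |inner ℝ n y - c|) (hσS : σ ⊆ S)
    (hσm : MeasurableSet σ) (hσ : σ ⊆ {x | inner ℝ n x = c})
    (hdiam : ∀ x ∈ S, ∀ y ∈ S, ‖y - x‖ ≤ h) {w : Pt d → ℝ} (hw : ContDiff ℝ 1 w) :
    ∫⁻ y in B, ∫⁻ x, ‖w x - w y‖ₑ ^ 2 ∂(surf σ)
      ≤ ENNReal.ofReal (h ^ 2) * (ENNReal.ofReal (2 ^ (d - 1) / δ) * volume B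
          + ENNReal.ofReal (2 ^ d) * surf σ univ) * ∫⁻ x in S, ‖fderiv ℝ w x‖ₑ ^ 2 := by
  have := sFinite_surf hn hσ
  have hc : Continuous (fderiv ℝ w) := hw.continuous_fderiv (by norm_num)
  -- By convexity the segments stay in `S`, so extension by zero loses nothing and allows
  -- integration over the full hyperplane and the full space.
  let f : Pt d → ℝ≥0∞ := S.indicator fun x => ‖fderiv ℝ w x‖ₑ ^ 2
  have hf : Measurable f := (hc.enorm.measurable.pow_const 2).indicator hSm
  have hfi : ∫⁻ x, f x = ∫⁻ x in S, ‖fderiv ℝ w x‖ₑ ^ 2 := lintegral_indicator hSm _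
  let I : Set ℝ → Pt d → Pt d → ℝ≥0∞ := fun J y x => ∫⁻ t in J, f (x + t • (y - x))
  have hI : ∀ J, Measurable fun q : Pt d × Pt d => I J q.1 q.2 := by
    intro J
    apply Measurable.lintegral_prod_right'
      (f := fun q : (Pt d × Pt d) × ℝ => f (q.1.2 + q.2 • (q.1.1 - q.1.2)))
    fun_prop
  have h1 : ∀ y ∈ B, ∀ x ∈ σ, ‖w x - w y‖ₑ ^ 2
      ≤ ENNReal.ofReal (h ^ 2) * (I (Icc 0 (1 / 2)) y x + I (Icc (1 / 2) 1) y x) := by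
    intro y hy x hx
    have hh : ‖y - x‖ ≤ h := hdiam x (hσS hx) y (hBS hy)
    rw [← enorm_neg, neg_sub]
    refine (enorm_sub_sq_le hw x y).trans ?_
    have h2 : ‖y - x‖ₑ ^ 2 ≤ ENNReal.ofReal (h ^ 2) := by
      rw [← ofReal_norm, ← ENNReal.ofReal_pow (norm_nonneg _)]
      gcongr
    refine mul_le_mul' h2 ?_
    calc _ = ∫⁻ t in Icc (0 : ℝ) 1, f (x + t • (y - x)) := by
          refine setLIntegral_congr_fun measurableSet_Icc fun t ht => ?_
          have : x + t • (y - x) ∈ S :=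
            hS.add_smul_sub_mem (hσS hx) (hBS hy) ht
          simp [f, this]
      _ ≤ ∫⁻ t in Icc (0 : ℝ) (1 / 2) ∪ Icc (1 / 2) 1, f (x + t • (y - x)) := by
          refine lintegral_mono_set fun t ht => ?_
          rcases le_total t (1 / 2) with h | h
          · exact Or.inl ⟨ht.1, h⟩
          · exact Or.inr ⟨h, ht.2⟩
      _ ≤ _ := lintegral_union_le _ _ _
  have h3 : ∫⁻ y in B, ∫⁻ x, I (Icc 0 (1 / 2)) y x ∂(surf σ)
      ≤ ENNReal.ofReal (2 ^ (d - 1) / δ) * volume B * ∫⁻ x, f x := by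
    calc _ ≤ ∫⁻ y in B, ENNReal.ofReal (2 ^ (d - 1) / δ) * ∫⁻ x, f x := by
          refine setLIntegral_mono' hBm fun y hy => ?_
          rw [lintegral_lintegral_swap (by fun_prop)]
          refine le_trans ?_ (lintegral_cone_le hn hδ (hBn y hy) hf)
          exact lintegral_mono fun t => lintegral_mono' (Measure.restrict_mono hσ le_rfl) le_rfl
      _ = _ := by simp only [lintegral_const, Measure.restrict_apply_univ]; ring
  have h4 : ∫⁻ y in B, ∫⁻ x, I (Icc (1 / 2) 1) y x ∂(surf σ)
      ≤ ENNReal.ofReal (2 ^ d) * surf σ univ * ∫⁻ x, f x := by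
    rw [lintegral_lintegral_swap (hI _).aemeasurable]
    calc _ ≤ ∫⁻ _, (ENNReal.ofReal (2 ^ d) * ∫⁻ x, f x) ∂(surf σ) := by
          refine lintegral_mono fun x => ?_
          rw [lintegral_lintegral_swap (by fun_prop)]
          calc _ ≤ ∫⁻ t in Icc (1 / 2 : ℝ) 1, ENNReal.ofReal (2 ^ d) * ∫⁻ x, f x := by
                refine setLIntegral_mono' measurableSet_Icc fun t ht => ?_
                have ht0 : (0 : ℝ) < t := by have := ht.1; linarith
                have h5 : ∀ y, f (x + t • (y - x)) = f (t • y + (1 - t) • x) := by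
                  intro y; congr 1; module
                simp only [h5]
                refine (setLIntegral_le_lintegral _ _).trans ?_
                rw [lintegral_comp_smul_add hf ht0.ne', finrank_euclideanSpace_fin]
                gcongr
                rw [abs_of_nonneg (by positivity), ← inv_pow]
                have h3 : t⁻¹ ≤ 2 := by
                  rw [inv_le_comm₀ ht0 (by norm_num)]
                  have := ht.1; linarith
                gcongr
            _ ≤ _ := by
                simp only [lintegral_const, Measure.restrict_apply_univ, Real.volume_Icc]
                -- The length `1/2` of the parameter interval is bounded by `1`.
                refine (mul_le_mul' le_rfl (b := _) (d := 1) ?_).trans (mul_one _).le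
                rw [ENNReal.ofReal_le_one]; norm_num
      _ = _ := by simp only [lintegral_const]; ring
  calc _ ≤ ∫⁻ y in B, ∫⁻ x, ENNReal.ofReal (h ^ 2) *
        (I (Icc 0 (1 / 2)) y x + I (Icc (1 / 2) 1) y x) ∂(surf σ) :=
        setLIntegral_mono' hBm fun y hy => setLIntegral_mono' hσm fun x hx => h1 y hy x hx
    _ = ENNReal.ofReal (h ^ 2) * ((∫⁻ y in B, ∫⁻ x, I (Icc 0 (1 / 2)) y x ∂(surf σ))
          + ∫⁻ y in B, ∫⁻ x, I (Icc (1 / 2) 1) y x ∂(surf σ)) := by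
        have hI1 : ∀ J y, Measurable (I J y) := fun J y =>
          (hI J).comp (measurable_const.prodMk measurable_id)
        rw [← lintegral_add_left ((hI _).lintegral_prod_right'),
          ← lintegral_const_mul _ (by
            exact ((hI _).lintegral_prod_right').add ((hI _).lintegral_prod_right'))]
        refine lintegral_congr fun y => ?_
        have hI2 : Measurable fun x => I (Icc 0 (1 / 2)) y x + I (Icc (1 / 2) 1) y x :=
          (hI1 _ y).add (hI1 _ y)
        rw [lintegral_const_mul _ hI2, lintegral_add_left (hI1 _ y)]
    _ ≤ _ := by
        rw [mul_assoc, add_mul, ← hfi]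
        gcongr

/-! ### Geometry of a simplex -/

section Simplices

variable {d : ℕ} [NeZero d] (S : Affine.Simplex ℝ (Pt d) d)

/-- The vertices of a `d`-simplex in `ℝ^d` as an affine basis. -/
def vertexBasis : AffineBasis (Fin (d + 1)) ℝ (Pt d) :=
  ⟨S.points, S.independent, by
    rw [S.independent.affineSpan_eq_top_iff_card_eq_finrank_add_one]; simp⟩

/-- Barycentric coordinates. -/
def bary (i : Fin (d + 1)) : Pt d →ᵃ[ℝ] ℝ := (vertexBasis S).coord i

/-- The closed facet opposite to the vertex `i`. -/
def facet (i : Fin (d + 1)) : Set (Pt d) := {x ∈ S.closedInterior | bary S i x = 0}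

theorem sum_bary (x : Pt d) : ∑ i, bary S i x = 1 := (vertexBasis S).sum_coord_apply_eq_one x

theorem bary_point (i j : Fin (d + 1)) : bary S i (S.points j) = if i = j then 1 else 0 :=
  (vertexBasis S).coord_apply i j

theorem combination_bary (x : Pt d) :
    Finset.univ.affineCombination ℝ S.points (fun i => bary S i x) = x :=
  (vertexBasis S).affineCombination_coord_eq_self x

theorem exists_bary_eq {a : Fin (d + 1) → ℝ} (ha : ∑ i, a i = 1) :
    ∃ x, ∀ i, bary S i x = a i :=
  ⟨Finset.univ.affineCombination ℝ S.points a, fun i =>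
    (vertexBasis S).coord_apply_combination_of_mem (Finset.mem_univ i) ha⟩

theorem continuous_bary (i : Fin (d + 1)) : Continuous (bary S i) :=
  AffineMap.continuous_of_finiteDimensional _

theorem mem_closedInterior_iff {x : Pt d} : x ∈ S.closedInterior ↔ ∀ i, 0 ≤ bary S i x := by
  rw [← S.convexHull_eq_closedInterior]
  change x ∈ convexHull ℝ (range (vertexBasis S)) ↔ _
  rw [(vertexBasis S).convexHull_eq_nonneg_coord]
  rfl

/-- Membership in the open simplex also asks that weights be less than `1`; this is automatic
because the weights sum to `1` and, as `d ≠ 0`, another one is positive. -/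
theorem mem_interior_iff {x : Pt d} : x ∈ S.interior ↔ ∀ i, 0 < bary S i x := by
  rw [← combination_bary S x, S.affineCombination_mem_interior_iff (sum_bary S x),
    combination_bary S x]
  refine ⟨fun h i => (h i).1, fun h i => ⟨h i, ?_⟩⟩
  rw [← sum_bary S x]
  have hd : d ≠ 0 := NeZero.ne d
  obtain ⟨j, hj⟩ : ∃ j : Fin (d + 1), j ≠ i := by
    have : Nontrivial (Fin (d + 1)) := Fin.nontrivial_iff_two_le.2 (by omega)
    exact exists_ne i
  exact Finset.single_lt_sum hj (Finset.mem_univ _) (Finset.mem_univ _) (h j) fun t _ _ => (h t).le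

theorem closedInterior_convex : Convex ℝ S.closedInterior := by
  rw [← S.convexHull_eq_closedInterior]
  exact convex_convexHull _ _

theorem interior_eq_interior : S.interior = interior S.closedInterior := by
  rw [← S.convexHull_eq_closedInterior]
  change _ = interior (convexHull ℝ (range (vertexBasis S)))
  rw [(vertexBasis S).interior_convexHull]
  ext x
  exact mem_interior_iff S

theorem isOpen_simplex_interior : IsOpen S.interior := by
  rw [interior_eq_interior]; exact isOpen_interior

theorem exists_center : ∃ x, ∀ i, bary S i x = ((d : ℝ) + 1)⁻¹ := by
  refine exists_bary_eq S ?_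
  have : (d : ℝ) + 1 ≠ 0 := by positivity
  simp [this]

theorem simplex_interior_nonempty : S.interior.Nonempty := by
  obtain ⟨x, hx⟩ := exists_center S
  refine ⟨x, (mem_interior_iff S).2 fun i => ?_⟩
  rw [hx]; positivity

theorem closure_simplex_interior : closure S.interior = S.closedInterior := by
  rw [interior_eq_interior, (closedInterior_convex S).closure_interior_eq_closure_of_nonempty_interior
    (by rw [← interior_eq_interior]; exact simplex_interior_nonempty S),
    S.isClosed_closedInterior.closure_eq]

theorem closedInterior_subset_interior_union :
    S.closedInterior ⊆ S.interior ∪ ⋃ i, facet S i := by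
  intro x hx
  by_cases h : ∃ i, bary S i x = 0
  · obtain ⟨i, hi⟩ := h
    exact Or.inr (mem_iUnion.2 ⟨i, hx, hi⟩)
  · push Not at h
    exact Or.inl ((mem_interior_iff S).2 fun i =>
      ((mem_closedInterior_iff S).1 hx i).lt_of_ne (h i).symm)

theorem measurableSet_facet (i : Fin (d + 1)) : MeasurableSet (facet S i) :=
  (S.isClosed_closedInterior.inter (isClosed_eq (continuous_bary S i) continuous_const)).measurableSet

/-- The assumption `2 ≤ d` makes the dimension `d - 1` of the facet nonzero, as the positivity
criterion for open faces requires. -/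
theorem mem_faceOpposite_interior (hd : 2 ≤ d) {i : Fin (d + 1)} {x : Pt d} (h0 : bary S i x = 0)
    (h : ∀ j, j ≠ i → 0 < bary S j x) : x ∈ (S.faceOpposite i).interior := by
  have : NeZero (d - 1) := ⟨by omega⟩
  rw [← combination_bary S x, Affine.Simplex.faceOpposite,
    S.affineCombination_mem_interior_face_iff_pos _ (sum_bary S x)]
  simpa using ⟨h, h0⟩

theorem bary_eq_zero_of_mem_convexHull {I : Set (Fin (d + 1))} {j : Fin (d + 1)} (hj : j ∉ I)
    {x : Pt d} (hx : x ∈ convexHull ℝ (S.points '' I)) : bary S j x = 0 := by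
  have h : convexHull ℝ (S.points '' I) ⊆ (bary S j) ⁻¹' {0} := by
    refine convexHull_min ?_ ((convex_singleton 0).affine_preimage _)
    rintro _ ⟨i, hi, rfl⟩
    have : j ≠ i := by rintro rfl; exact hj hi
    simp [bary_point, this]
  exact h hx

theorem facet_subset_convexHull {I : Set (Fin (d + 1))} {i : Fin (d + 1)} (hI : {i}ᶜ ⊆ I) :
    facet S i ⊆ convexHull ℝ (S.points '' I) := by
  rintro x ⟨hx, hi⟩
  have h1 := (vertexBasis S).linear_combination_coord_eq_self x
  rw [← h1, ← Finset.sum_erase Finset.univ (a := i)]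
  · refine (convex_convexHull ℝ _).sum_mem (fun j _ => (mem_closedInterior_iff S).1 hx j) ?_ ?_
    · have h2 := sum_bary S x
      rw [← Finset.sum_erase (f := fun j => bary S j x) Finset.univ hi] at h2
      exact h2
    · intro j hj
      exact subset_convexHull ℝ _ ⟨j, hI (Finset.ne_of_mem_erase hj), rfl⟩
  · change bary S i x • _ = _
    rw [hi, zero_smul]

/-! ### Shape regularity -/

/-- The reciprocal of the inradius is the sum of the reciprocals of the heights. -/
theorem inradius_le_height (i : Fin (d + 1)) : S.inradius ≤ S.height i := by
  have hs : ∀ i, 0 < (S.height i)⁻¹ := fun i => inv_pos.2 (S.height_pos i)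
  have h1 : S.inradius = (∑ i, (S.height i)⁻¹)⁻¹ := by
    rw [S.inradius_eq_abs_inv_sum, abs_of_nonneg]
    · simp [Affine.Simplex.excenterWeightsUnnorm]
    · rw [inv_nonneg]
      refine Finset.sum_nonneg fun i _ => ?_
      simpa [Affine.Simplex.excenterWeightsUnnorm] using (S.height_pos i).le
  rw [h1, inv_le_comm₀ (Finset.sum_pos (fun i _ => hs i) Finset.univ_nonempty) (S.height_pos i)]
  exact Finset.single_le_sum (f := fun i => (S.height i)⁻¹) (fun i _ => (hs i).le)
    (Finset.mem_univ i)

/-- A barycentric coordinate times the height is the signed distance to the hyperplane of the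
opposite facet; the normal is the altitude divided by its length. -/
theorem exists_normal (i : Fin (d + 1)) :
    ∃ (n : Pt d) (c : ℝ), ‖n‖ = 1 ∧ ∀ x, inner ℝ n x - c = bary S i x * S.height i := by
  have hh := S.height_pos i
  set q := S.altitudeFoot i
  refine ⟨(S.height i)⁻¹ • (S.points i - q), inner ℝ ((S.height i)⁻¹ • (S.points i - q)) q,
    ?_, fun x => ?_⟩
  · rw [norm_smul, ← dist_eq_norm, norm_inv, Real.norm_of_nonneg hh.le]
    exact inv_mul_cancel₀ hh.ne'
  · have hself : inner ℝ (S.points i - q) (S.points i - q) = S.height i ^ 2 := by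
      rw [real_inner_self_eq_norm_sq, ← dist_eq_norm]; rfl
    have h1 : ∀ j, inner ℝ (S.points i - q) (S.points j - q)
        = if j = i then S.height i ^ 2 else 0 := by
      intro j
      split_ifs with hj
      · rw [hj, hself]
      · rw [real_inner_comm]
        exact S.inner_vsub_altitudeFoot_vsub_altitudeFoot_eq_zero (Ne.symm hj)
    have h3 := (vertexBasis S).linear_combination_coord_eq_self x
    have h4 : x - q = ∑ j, bary S j x • (S.points j - q) := by
      simp only [smul_sub, Finset.sum_sub_distrib, ← Finset.sum_smul, sum_bary, one_smul]
      exact congrArg (· - q) h3.symm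
    rw [← inner_sub_right, h4, inner_smul_left, inner_sum]
    simp only [inner_smul_right, h1]
    simp
    field_simp

variable {S}

theorem abs_bary_sub_le {r : ℝ} (hr : 0 < r) (hrS : r ≤ S.inradius) (i : Fin (d + 1)) (x y : Pt d) :
    |bary S i x - bary S i y| ≤ ‖x - y‖ / r := by
  obtain ⟨n, c, hn, h⟩ := exists_normal S i
  have hh : r ≤ S.height i := hrS.trans (inradius_le_height S i)
  have h1 : (bary S i x - bary S i y) * S.height i = inner ℝ n (x - y) := by
    rw [inner_sub_right]; linarith [h x, h y]
  have h2 : |bary S i x - bary S i y| * S.height i ≤ ‖x - y‖ := by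
    rw [← abs_of_pos (hr.trans_le hh), ← abs_mul, h1]
    simpa [hn] using abs_real_inner_le_norm n (x - y)
  rw [le_div_iff₀ hr]
  exact (mul_le_mul_of_nonneg_left hh (abs_nonneg _)).trans h2

/-- At the barycenter all coordinates are `1/(d+1)`, and by their Lipschitz constant `1/r` they lose
at most half of this within the given radius. -/
theorem exists_inner_ball {r : ℝ} (hr : 0 < r) (hrS : r ≤ S.inradius) : ∃ x0 : Pt d,
    ∀ x ∈ Metric.closedBall x0 (r / (2 * (d + 1))), ∀ i, 1 / (2 * (d + 1)) ≤ bary S i x := by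
  obtain ⟨x0, hx0⟩ := exists_center S
  refine ⟨x0, fun x hx i => ?_⟩
  have h1 := abs_bary_sub_le hr hrS i x x0
  rw [hx0] at h1
  have h2 : ‖x - x0‖ / r ≤ 1 / (2 * (d + 1)) := by
    rw [Metric.mem_closedBall, dist_eq_norm] at hx
    rw [div_le_iff₀ hr]
    refine hx.trans (le_of_eq ?_)
    field_simp
  have h3 := neg_le_of_abs_le (h1.trans h2)
  have h4 : ((d : ℝ) + 1)⁻¹ = 1 / (2 * (d + 1)) + 1 / (2 * (d + 1)) := by field_simp; norm_num
  linarith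

theorem dist_points_ge {r : ℝ} (hr : 0 < r) (hrS : r ≤ S.inradius) {i j : Fin (d + 1)} (hij : i ≠ j) :
    r ≤ dist (S.points i) (S.points j) := by
  have h := abs_bary_sub_le hr hrS i (S.points i) (S.points j)
  rw [bary_point, bary_point, if_pos rfl, if_neg hij, sub_zero, abs_one, le_div_iff₀ hr, one_mul] at h
  rwa [dist_eq_norm]

end Simplices

/-! ### The trace inequality on a simplex -/

/-- The volume of the unit ball of `ℝ^m`. -/
def unitVol (m : ℕ) : ℝ := volume.real (Metric.ball (0 : Pt m) 1)

theorem unitVol_pos (m : ℕ) : 0 < unitVol m :=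
  ENNReal.toReal_pos (Metric.measure_ball_pos _ _ one_pos).ne' measure_ball_lt_top.ne

theorem ofReal_unitVol (m : ℕ) : ENNReal.ofReal (unitVol m) = volume (Metric.ball (0 : Pt m) 1) :=
  ENNReal.ofReal_toReal measure_ball_lt_top.ne

theorem volume_closedBall_eq {d : ℕ} (x : Pt d) {R : ℝ} (hR : 0 ≤ R) :
    volume (Metric.closedBall x R) = ENNReal.ofReal (R ^ d * unitVol d) := by
  rw [Measure.addHaar_closedBall _ _ hR, finrank_euclideanSpace_fin,
    ENNReal.ofReal_mul (by positivity), ofReal_unitVol]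

theorem volume_ball_hyp {d : ℕ} {n : Pt d} (hn : ‖n‖ = 1) :
    volume (Metric.ball (0 : hyp n) 1) = ENNReal.ofReal (unitVol (d - 1)) := by
  let b := (stdOrthonormalBasis ℝ (hyp n)).reindex (finCongr (finrank_hyp hn))
  rw [ofReal_unitVol, ← b.measurePreserving_repr.measure_preimage
    Metric.isOpen_ball.measurableSet.nullMeasurableSet]
  congr 1
  ext z
  simp

theorem surf_ball_eq {d : ℕ} {n : Pt d} (hn : ‖n‖ = 1) {c : ℝ} {x : Pt d} (hx : inner ℝ n x = c)
    {R : ℝ} (hR : 0 ≤ R) :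
    surf ({x | inner ℝ n x = c} ∩ Metric.closedBall x R) univ
      = ENNReal.ofReal (R ^ (d - 1) * unitVol (d - 1)) := by
  rw [Measure.restrict_apply_univ, inter_comm,
    ← Measure.restrict_apply Metric.isClosed_closedBall.measurableSet,
    surf_closedBall hn hx hR, volume_ball_hyp hn, ENNReal.ofReal_mul (by positivity)]

section SimplexTrace

variable {d : ℕ} [NeZero d] {S : Affine.Simplex ℝ (Pt d) d}

theorem exists_facet_center (i : Fin (d + 1)) :
    ∃ x, bary S i x = 0 ∧ ∀ j, j ≠ i → bary S j x = (d : ℝ)⁻¹ := by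
  have hd : (d : ℝ) ≠ 0 := Nat.cast_ne_zero.2 (NeZero.ne d)
  obtain ⟨x, hx⟩ := exists_bary_eq S (a := fun j => if j = i then 0 else (d : ℝ)⁻¹) (by
    simp [Finset.sum_ite, Finset.filter_ne', Finset.card_erase_of_mem, hd])
  exact ⟨x, by simp [hx], fun j hj => by simp [hx, hj]⟩

theorem surf_facet_le {h : ℝ} (hh : ∀ x ∈ S.closedInterior, ∀ y ∈ S.closedInterior, ‖y - x‖ ≤ h)
    (i : Fin (d + 1)) :
    surf (facet S i) univ ≤ ENNReal.ofReal (h ^ (d - 1) * unitVol (d - 1)) := by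
  obtain ⟨n, c, hn, hb⟩ := exists_normal S i
  obtain ⟨x, hx0, hx⟩ := exists_facet_center (S := S) i
  have hxS : x ∈ S.closedInterior := (mem_closedInterior_iff S).2 fun j => by
    by_cases hj : j = i
    · rw [hj, hx0]
    · rw [hx j hj]; positivity
  have hH : ∀ y, bary S i y = 0 → inner ℝ n y = c := fun y hy => by
    have := hb y; rw [hy, zero_mul] at this; linarith
  have h0 : 0 ≤ h := by simpa using hh x hxS x hxS
  rw [← surf_ball_eq hn (hH x hx0) h0, Measure.restrict_apply_univ, Measure.restrict_apply_univ]
  exact measure_mono fun y hy => ⟨hH y hy.2, by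
    rw [Metric.mem_closedBall, dist_eq_norm]; exact hh x hxS y hy.1⟩

/-- The coordinates other than `i` equal `1/d` at the barycenter of the facet and are
`1/r`-Lipschitz, so the facet contains the flat disc of radius `r/d` around it. -/
theorem le_surf_facet {r : ℝ} (hr : 0 < r) (hrS : r ≤ S.inradius) (i : Fin (d + 1)) :
    ENNReal.ofReal ((r / d) ^ (d - 1) * unitVol (d - 1)) ≤ surf (facet S i) univ := by
  have hd : (0 : ℝ) < d := Nat.cast_pos.2 (NeZero.pos d)
  obtain ⟨n, c, hn, hb⟩ := exists_normal S i
  obtain ⟨x, hx0, hx⟩ := exists_facet_center (S := S) i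
  have hxc : inner ℝ n x = c := by have := hb x; rw [hx0, zero_mul] at this; linarith
  rw [← surf_ball_eq hn hxc (by positivity), Measure.restrict_apply_univ,
    Measure.restrict_apply_univ]
  refine measure_mono fun y hy => ?_
  have hy0 : bary S i y = 0 := by
    have h1 := hb y
    rw [show inner ℝ n y = c from hy.1, sub_self] at h1
    exact (mul_eq_zero.1 h1.symm).resolve_right (S.height_pos i).ne'
  refine ⟨(mem_closedInterior_iff S).2 fun j => ?_, hy0⟩
  by_cases hj : j = i
  · rw [hj, hy0]
  · have h1 := abs_bary_sub_le hr hrS j y x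
    have h2 := hy.2
    rw [Metric.mem_closedBall, dist_eq_norm] at h2
    have h3 : ‖y - x‖ / r ≤ (d : ℝ)⁻¹ := by
      rw [div_le_iff₀ hr]; exact h2.trans (le_of_eq (by field_simp))
    have h4 := neg_le_of_abs_le (h1.trans h3)
    rw [hx j hj] at h4
    linarith

theorem isBounded_facet (i : Fin (d + 1)) : Bornology.IsBounded (facet S i) :=
  S.isCompact_closedInterior.isBounded.subset fun _ hx => hx.1

theorem surf_facet_ne_top (i : Fin (d + 1)) : surf (facet S i) univ ≠ ⊤ := by
  refine ne_top_of_le_ne_top ?_ (surf_facet_le (h := Metric.diam S.closedInterior)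
    (fun x hx y hy => ?_) i)
  · exact ENNReal.ofReal_ne_top
  · rw [← dist_eq_norm]
    exact Metric.dist_le_diam_of_mem S.isCompact_closedInterior.isBounded hy hx

theorem integrable_facet (i : Fin (d + 1)) {g : Pt d → ℝ} (hg : Continuous g) :
    Integrable g (surf (facet S i)) :=
  integrableOn_of_continuous _ _ (isBounded_facet i) (measurableSet_facet S i)
    (by simpa using surf_facet_ne_top i) hg

/-- The constant of the trace inequality on a simplex whose inradius is at least `κ h`. -/
def traceConst (d : ℕ) (κ : ℝ) : ℝ :=
  (d + 1) * (2 ^ (d - 1) / (κ / (2 * (d + 1)))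
    + 2 ^ d * unitVol (d - 1) / ((κ / (2 * (d + 1))) ^ d * unitVol d))

theorem traceConst_pos (d : ℕ) {κ : ℝ} (hκ : 0 < κ) : 0 < traceConst d κ := by
  have := unitVol_pos d
  have := unitVol_pos (d - 1)
  unfold traceConst
  positivity

/-- The inequality for pairs is averaged over `y` in an interior ball of radius comparable to `h`.
Some `y` does no worse than the average, and `a = w y` then serves all facets at once because their
contributions were summed before averaging. -/
theorem exists_sum_facet_le {κ h : ℝ} (hκ : 0 < κ) (hh0 : 0 < h) (hrS : κ * h ≤ S.inradius)
    (hh : ∀ x ∈ S.closedInterior, ∀ y ∈ S.closedInterior, ‖y - x‖ ≤ h) {w : Pt d → ℝ}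
    (hw : ContDiff ℝ 1 w) :
    ∃ a : ℝ, ∑ i, ∫ x, (w x - a) ^ 2 ∂(surf (facet S i))
      ≤ traceConst d κ * h * ∫ x in S.closedInterior, ‖fderiv ℝ w x‖ ^ 2 := by
  have hd : (0 : ℝ) < d := Nat.cast_pos.2 (NeZero.pos d)
  have hd1 : (0 : ℝ) < d + 1 := by positivity
  have hr : 0 < κ * h := by positivity
  have hω := unitVol_pos d
  have hω' := unitVol_pos (d - 1)
  have hc : Continuous (fderiv ℝ w) := hw.continuous_fderiv (by norm_num)
  obtain ⟨x0, hx0⟩ := exists_inner_ball hr hrS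
  set δ := κ * h / (2 * (d + 1)) with hδ
  have hδ0 : 0 < δ := by positivity
  set B := Metric.closedBall x0 δ
  have hBm : MeasurableSet B := Metric.isClosed_closedBall.measurableSet
  have hBS : B ⊆ S.closedInterior := fun x hx => (mem_closedInterior_iff S).2 fun i =>
    le_trans (by positivity) (hx0 x hx i)
  have hSm : MeasurableSet S.closedInterior := S.isClosed_closedInterior.measurableSet
  have hB : volume B = ENNReal.ofReal (δ ^ d * unitVol d) := volume_closedBall_eq _ hδ0.le
  set G := ∫ x in S.closedInterior, ‖fderiv ℝ w x‖ ^ 2 with hG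
  have hG0 : 0 ≤ G := integral_nonneg fun x => by positivity
  have hGi : ∫⁻ x in S.closedInterior, ‖fderiv ℝ w x‖ₑ ^ 2 = ENNReal.ofReal G := by
    rw [hG, ofReal_integral_eq_lintegral_ofReal]
    · simp [ENNReal.ofReal_pow]
    · exact integrableOn_of_continuous _ _ S.isCompact_closedInterior.isBounded hSm
        S.isCompact_closedInterior.measure_lt_top.ne (by fun_prop)
    · exact Eventually.of_forall fun x => by positivity
  -- The bound of `lintegral_pairs_le` for one facet, with facet area at most that of a disc of
  -- radius `h`.
  let X : ℝ := h ^ 2 * (2 ^ (d - 1) / δ * (δ ^ d * unitVol d)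
    + 2 ^ d * (h ^ (d - 1) * unitVol (d - 1))) * G
  have hi : ∀ i, ∫⁻ y in B, ∫⁻ x, ‖w x - w y‖ₑ ^ 2 ∂(surf (facet S i)) ≤ ENNReal.ofReal X := by
    intro i
    obtain ⟨n, c, hn, hb⟩ := exists_normal S i
    have hfH : facet S i ⊆ {x | inner ℝ n x = c} := fun y hy => by
      have := hb y; rw [hy.2, zero_mul] at this
      exact sub_eq_zero.1 this
    refine (lintegral_pairs_le hn hδ0 (closedInterior_convex S) hSm hBS hBm (fun y hy => ?_)
      (fun x hx => hx.1) (measurableSet_facet S i) hfH hh hw).trans ?_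
    -- Points of the ball keep distance `δ` from every facet hyperplane: coordinate at least
    -- `1/(2(d+1))` times height at least `κ h`.
    · rw [hb, abs_of_nonneg (mul_nonneg ((mem_closedInterior_iff S).1 (hBS hy) i)
        (S.height_pos i).le)]
      calc δ = 1 / (2 * (d + 1)) * (κ * h) := by rw [hδ]; ring
        _ ≤ _ := mul_le_mul (hx0 y hy i) (hrS.trans (inradius_le_height S i)) hr.le
            ((mem_closedInterior_iff S).1 (hBS hy) i)
    · rw [hGi, hB]
      refine (mul_le_mul' (mul_le_mul' le_rfl (add_le_add le_rfl
        (mul_le_mul' le_rfl (surf_facet_le hh i)))) le_rfl).trans (le_of_eq ?_)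
      rw [← ENNReal.ofReal_mul (by positivity), ← ENNReal.ofReal_mul (by positivity),
        ← ENNReal.ofReal_add (by positivity) (by positivity), ← ENNReal.ofReal_mul (by positivity),
        ← ENNReal.ofReal_mul (by positivity)]
  have hsf : ∀ i, SFinite (surf (facet S i)) := fun i => by
    have : IsFiniteMeasure (surf (facet S i)) := ⟨(surf_facet_ne_top i).lt_top⟩
    infer_instance
  have hm : ∀ i, Measurable fun y => ∫⁻ x, ‖w x - w y‖ₑ ^ 2 ∂(surf (facet S i)) := fun i => by
    have := hsf i
    have hwc := hw.continuous
    apply Measurable.lintegral_prod_right' (f := fun q : Pt d × Pt d => ‖w q.2 - w q.1‖ₑ ^ 2)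
    exact (Continuous.measurable (by fun_prop)).pow_const 2
  have hBpos : 0 < δ ^ d * unitVol d := by positivity
  obtain ⟨y, -, hy⟩ := exists_le_setLAverage (μ := volume) (s := B)
    (f := fun y => ∑ i, ∫⁻ x, ‖w x - w y‖ₑ ^ 2 ∂(surf (facet S i)))
    (by rw [hB]; simpa using hBpos) (by rw [hB]; exact ENNReal.ofReal_ne_top)
    (Finset.measurable_sum _ fun i _ => hm i).aemeasurable
  refine ⟨w y, ?_⟩
  have h1 : ENNReal.ofReal (∑ i, ∫ x, (w x - w y) ^ 2 ∂(surf (facet S i)))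
      = ∑ i, ∫⁻ x, ‖w x - w y‖ₑ ^ 2 ∂(surf (facet S i)) := by
    rw [ENNReal.ofReal_sum_of_nonneg fun i _ => integral_nonneg fun x => by positivity]
    refine Finset.sum_congr rfl fun i _ => ?_
    rw [ofReal_integral_eq_lintegral_ofReal]
    · refine lintegral_congr fun x => ?_
      rw [← sq_abs, ENNReal.ofReal_pow (abs_nonneg _), ← Real.enorm_eq_ofReal_abs]
    · have hwc := hw.continuous
      exact integrable_facet i (by fun_prop)
    · exact Eventually.of_forall fun x => by positivity
  have h2 : ∑ i, ∫ x, (w x - w y) ^ 2 ∂(surf (facet S i)) ≤ (d + 1) * X / (δ ^ d * unitVol d) := by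
    rw [← ENNReal.ofReal_le_ofReal_iff (by positivity), h1]
    refine hy.trans ?_
    rw [setLAverage_eq, lintegral_finsetSum _ fun i _ => hm i, ENNReal.ofReal_div_of_pos hBpos, hB]
    gcongr
    refine (Finset.sum_le_card_nsmul _ _ _ fun i _ => hi i).trans (le_of_eq ?_)
    have h3 : ENNReal.ofReal ((d : ℝ) + 1) = d + 1 := by
      exact_mod_cast ENNReal.ofReal_natCast (d + 1)
    rw [ENNReal.ofReal_mul (p := (d : ℝ) + 1) (by positivity), h3]
    simp only [Finset.card_univ, Fintype.card_fin, nsmul_eq_mul, Nat.cast_add, Nat.cast_one]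
  refine h2.trans (le_of_eq ?_)
  have hhd : h ^ d = h * h ^ (d - 1) := by
    rw [← pow_succ', Nat.sub_add_cancel (NeZero.pos d)]
  have e : δ = κ / (2 * (d + 1)) * h := by rw [hδ]; ring
  simp only [X, traceConst, e, mul_pow, hhd]
  field_simp

end SimplexTrace

/-! ### Elements are connected through facets of the submesh -/

/-- General position: from a point where the earlier functions are nonzero and the new one vanishes,
a small move towards a point of `H` where the new one is nonzero keeps the earlier conditions, which
are open. Along that line the new function is linear in `t` and vanishes only at `t = 0`. -/
theorem exists_forall_affine_ne_zero {V : Type*} [NormedAddCommGroup V] [NormedSpace ℝ V]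
    {H U : Set V} (hH : ∀ x ∈ H, ∀ y ∈ H, ∀ t : ℝ, AffineMap.lineMap x y t ∈ H) (hU : IsOpen U)
    (hne : (H ∩ U).Nonempty) {ι : Type*} (s : Finset ι) {f : ι → V →ᵃ[ℝ] ℝ}
    (hc : ∀ i, Continuous (f i)) (hf : ∀ i ∈ s, ∃ x ∈ H, f i x ≠ 0) :
    ∃ x ∈ H ∩ U, ∀ i ∈ s, f i x ≠ 0 := by
  classical
  induction s using Finset.induction with
  | empty =>
    obtain ⟨x, hx⟩ := hne
    exact ⟨x, hx, by simp⟩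
  | insert a s _ ih =>
    obtain ⟨x, hx, hxs⟩ := ih fun i hi => hf i (Finset.mem_insert_of_mem hi)
    by_cases hxa : f a x = 0
    · obtain ⟨v, hv, hva⟩ := hf a (Finset.mem_insert_self _ _)
      have hO : IsOpen (U ∩ ⋂ i ∈ s, {y | f i y ≠ 0}) :=
        hU.inter (isOpen_biInter_finset fun i _ => isOpen_ne_fun (hc i) continuous_const)
      have hl : Continuous fun t : ℝ => (AffineMap.lineMap x v t : V) := AffineMap.lineMap_continuous
      have h0 : (AffineMap.lineMap x v (0 : ℝ) : V) ∈ U ∩ ⋂ i ∈ s, {y | f i y ≠ 0} := by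
        rw [AffineMap.lineMap_apply_zero]
        exact ⟨hx.2, mem_iInter₂.2 hxs⟩
      have h1 : ∀ᶠ t in 𝓝[≠] (0 : ℝ), (AffineMap.lineMap x v t : V) ∈ U ∩ ⋂ i ∈ s, {y | f i y ≠ 0} :=
        (hl.continuousAt.eventually (hO.mem_nhds h0)).filter_mono nhdsWithin_le_nhds
      obtain ⟨t, ht, ht0⟩ := (h1.and self_mem_nhdsWithin).exists
      refine ⟨_, ⟨hH x hx.1 v hv t, ht.1⟩, fun i hi => ?_⟩
      rcases Finset.mem_insert.1 hi with rfl | hi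
      · rw [AffineMap.apply_lineMap, AffineMap.lineMap_apply, hxa]
        simpa [hva] using ht0
      · exact mem_iInter₂.1 ht.2 i hi
    · exact ⟨x, hx, fun i hi => by
        rcases Finset.mem_insert.1 hi with rfl | hi
        · exact hxa
        · exact hxs i hi⟩

section Submesh

variable {d : ℕ} [NeZero d] {Ω : Set (Pt d)} {M : Mesh Ω}

/-- The simplices of the submesh that lie in the element `T`. -/
def Submesh.inElem (K : Submesh M) (T : Fin M.nElem) : Finset (Fin K.n) :=
  letI : DecidablePred fun S => (K.simplex S).interior ⊆ M.elem T := Classical.decPred _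
  Finset.univ.filter fun S => (K.simplex S).interior ⊆ M.elem T

theorem Submesh.mem_inElem {K : Submesh M} {T : Fin M.nElem} {S : Fin K.n} :
    S ∈ K.inElem T ↔ (K.simplex S).interior ⊆ M.elem T := by
  simp [Submesh.inElem]

/-- A point of `T` outside these simplices would be a limit of interior points of another simplex;
that simplex then meets `T`, so by nestedness it lies in `T`. -/
theorem Submesh.closure_elem_subset (K : Submesh M) (T : Fin M.nElem) :
    closure (M.elem T) ⊆ ⋃ S ∈ K.inElem T, (K.simplex S).closedInterior := by
  set Z := ⋃ S ∈ K.inElem T, (K.simplex S).closedInterior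
  have hZ : IsClosed Z :=
    (K.inElem T).finite_toSet.isClosed_biUnion fun S _ => (K.simplex S).isClosed_closedInterior
  refine closure_minimal (fun x hx => ?_) hZ
  by_contra hxZ
  have hxΩ : x ∈ closure Ω := by
    rw [M.elem_cover]; exact mem_iUnion.2 ⟨T, subset_closure hx⟩
  rw [K.cover] at hxΩ
  obtain ⟨S, hS⟩ := mem_iUnion.1 hxΩ
  rw [← closure_simplex_interior] at hS
  obtain ⟨y, ⟨hyT, hyZ⟩, hyS⟩ := mem_closure_iff.1 hS (M.elem T ∩ Zᶜ)
    ((M.elem_polytope T).isOpen.inter hZ.isOpen_compl) ⟨hx, hxZ⟩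
  obtain ⟨T', hT', -⟩ := K.nested S
  have hTT : T' = T := by
    by_contra h
    exact (M.elem_disjoint T' T h).ne_of_mem (hT' hyS) hyT rfl
  subst hTT
  exact hyZ (mem_biUnion (Submesh.mem_inElem.2 hT')
    ((K.simplex S).interior_subset_closedInterior hyS))

theorem Submesh.closedInterior_subset {K : Submesh M} {T : Fin M.nElem} {S : Fin K.n}
    (hS : S ∈ K.inElem T) : (K.simplex S).closedInterior ⊆ closure (M.elem T) := by
  rw [← closure_simplex_interior]
  exact closure_mono (Submesh.mem_inElem.1 hS)

theorem exists_bary_ne (S : Affine.Simplex ℝ (Pt d) d) {i j : Fin (d + 1)} (hij : i ≠ j) {a : Pt d}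
    (ha : bary S j a ≠ 0) : ∃ x, bary S i x * bary S j a - bary S j x * bary S i a ≠ 0 :=
  ⟨S.points i, by simp [bary_point, hij.symm, ha]⟩

/-- Connectedness of `T` gives a point common to the closed unions over `A` and `B`. Near it, a
segment in general position joins a simplex of `A` to one of `B` inside `T` and avoids all faces of
codimension two. Where it meets both unions, two simplices share a face that misses at most one
vertex, hence a facet. -/
theorem Submesh.exists_facet_subset (K : Submesh M) (T : Fin M.nElem) {A B : Finset (Fin K.n)}
    (hA : A.Nonempty) (hB : B.Nonempty) (hAT : A ⊆ K.inElem T) (hBT : B ⊆ K.inElem T)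
    (hAB : K.inElem T ⊆ A ∪ B) (hd : Disjoint A B) :
    ∃ S ∈ A, ∃ S' ∈ B, ∃ i, facet (K.simplex S) i ⊆ (K.simplex S').closedInterior := by
  let Z : Finset (Fin K.n) → Set (Pt d) := fun A => ⋃ S ∈ A, (K.simplex S).closedInterior
  have hZ : ∀ A, IsClosed (Z A) := fun A =>
    A.finite_toSet.isClosed_biUnion fun S _ => (K.simplex S).isClosed_closedInterior
  have hcov : M.elem T ⊆ Z A ∪ Z B := by
    intro x hx
    obtain ⟨S, hS, hxS⟩ := mem_iUnion₂.1 (K.closure_elem_subset T (subset_closure hx))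
    rcases Finset.mem_union.1 (hAB hS) with h | h
    · exact Or.inl (mem_biUnion h hxS)
    · exact Or.inr (mem_biUnion h hxS)
  have hmeet : ∀ A : Finset (Fin K.n), A.Nonempty → A ⊆ K.inElem T → (M.elem T ∩ Z A).Nonempty := by
    rintro A ⟨S, hS⟩ hAT
    obtain ⟨x, hx⟩ := simplex_interior_nonempty (K.simplex S)
    exact ⟨x, Submesh.mem_inElem.1 (hAT hS) hx,
      mem_biUnion hS ((K.simplex S).interior_subset_closedInterior hx)⟩
  obtain ⟨x, hxT, hxA, hxB⟩ := isPreconnected_closed_iff.1 (M.elem_polytope T).1.isPreconnected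
    _ _ (hZ A) (hZ B) hcov (hmeet A hA hAT) (hmeet B hB hBT)
  obtain ⟨ε, hε, hball⟩ := Metric.isOpen_iff.1 (M.elem_polytope T).isOpen x hxT
  have hnear : ∀ A : Finset (Fin K.n), x ∈ Z A →
      ∃ S ∈ A, (Metric.ball x ε ∩ (K.simplex S).interior).Nonempty := by
    intro A hxA
    obtain ⟨S, hS, hxS⟩ := mem_iUnion₂.1 hxA
    rw [← closure_simplex_interior] at hxS
    exact ⟨S, hS, mem_closure_iff.1 hxS _ Metric.isOpen_ball (Metric.mem_ball_self hε)⟩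
  obtain ⟨SA, hSA, hUA⟩ := hnear A hxA
  obtain ⟨SB, hSB, hUB⟩ := hnear B hxB
  -- First endpoint: off all facet hyperplanes of all simplices.
  obtain ⟨a, ⟨-, haU⟩, ha⟩ := exists_forall_affine_ne_zero (H := univ)
    (U := Metric.ball x ε ∩ (K.simplex SA).interior) (fun _ _ _ _ _ => mem_univ _)
    (Metric.isOpen_ball.inter (isOpen_simplex_interior _)) (by simpa using hUA)
    (Finset.univ : Finset (Fin K.n × Fin (d + 1))) (f := fun q => bary (K.simplex q.1) q.2)
    (fun q => continuous_bary _ _) (fun q _ => ⟨(K.simplex q.1).points q.2, mem_univ _, by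
      simp [bary_point]⟩)
  -- Second endpoint: off every hyperplane spanned by `a` and a codimension-two space where the
  -- coordinates `i` and `j` vanish. Its equation is the combination of the two coordinates that
  -- vanishes at `a`.
  obtain ⟨b, ⟨-, hbU⟩, hb⟩ := exists_forall_affine_ne_zero (H := univ)
    (U := Metric.ball x ε ∩ (K.simplex SB).interior) (fun _ _ _ _ _ => mem_univ _)
    (Metric.isOpen_ball.inter (isOpen_simplex_interior _)) (by simpa using hUB)
    ((Finset.univ : Finset (Fin K.n × Fin (d + 1) × Fin (d + 1))).filter fun q => q.2.1 ≠ q.2.2)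
    (f := fun q => (bary (K.simplex q.1) q.2.2 a) • bary (K.simplex q.1) q.2.1
      - (bary (K.simplex q.1) q.2.1 a) • bary (K.simplex q.1) q.2.2)
    (fun q => AffineMap.continuous_of_finiteDimensional _) (fun q hq => by
      obtain ⟨x, hx⟩ := exists_bary_ne (K.simplex q.1) (Finset.mem_filter.1 hq).2
        (ha (q.1, q.2.2) (Finset.mem_univ _))
      refine ⟨x, mem_univ _, ?_⟩
      simpa [mul_comm] using hx)
  have hseg : segment ℝ a b ⊆ M.elem T :=
    ((convex_ball x ε).segment_subset haU.1 hbU.1).trans hball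
  obtain ⟨y, hys, hyA, hyB⟩ := isPreconnected_closed_iff.1
    (convex_segment a b).isPreconnected _ _ (hZ A) (hZ B) (hseg.trans hcov)
    ⟨a, left_mem_segment ℝ a b,
      mem_biUnion hSA ((K.simplex SA).interior_subset_closedInterior haU.2)⟩
    ⟨b, right_mem_segment ℝ a b,
      mem_biUnion hSB ((K.simplex SB).interior_subset_closedInterior hbU.2)⟩
  obtain ⟨S, hS, hyS⟩ := mem_iUnion₂.1 hyA
  obtain ⟨S', hS', hyS'⟩ := mem_iUnion₂.1 hyB
  have hne : S ≠ S' := fun h => Finset.disjoint_left.1 hd hS (h ▸ hS')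
  obtain ⟨I, hI⟩ := K.conforming S S' hne
  have hyI : y ∈ convexHull ℝ ((K.simplex S).points '' I) := hI ▸ ⟨hyS, hyS'⟩
  obtain ⟨t, ht, rfl⟩ : ∃ t ∈ Icc (0 : ℝ) 1, AffineMap.lineMap a b t = y := by
    rwa [segment_eq_image_lineMap] at hys
  -- If the common face missed two vertices, both coordinates would vanish at the crossing point.
  -- Eliminating between the two equations forces `t = 0` by the choice of `b`, so the crossing
  -- point is `a`, against the choice of `a`.
  have hcard : ∀ i j, i ∉ I → j ∉ I → i = j := by
    intro i j hi hj
    by_contra hij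
    have h1 := bary_eq_zero_of_mem_convexHull _ hi hyI
    have h2 := bary_eq_zero_of_mem_convexHull _ hj hyI
    have h3 := hb (S, i, j) (by simpa using hij)
    simp only [AffineMap.apply_lineMap, AffineMap.lineMap_apply_ring'] at h1 h2
    simp only [AffineMap.coe_sub, AffineMap.coe_smul, Pi.sub_apply, Pi.smul_apply,
      smul_eq_mul] at h3
    have hti : t * (bary (K.simplex S) j a * bary (K.simplex S) i b
        - bary (K.simplex S) i a * bary (K.simplex S) j b) = 0 := by
      linear_combination bary (K.simplex S) j a * h1 - bary (K.simplex S) i a * h2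
    have ht0 : t = 0 := (mul_eq_zero.1 hti).resolve_right h3
    rw [ht0, zero_mul, zero_add] at h1
    exact ha (S, i) (Finset.mem_univ _) h1
  obtain ⟨i, hi⟩ : ∃ i : Fin (d + 1), {i}ᶜ ⊆ I := by
    by_cases h : ∃ i, i ∉ I
    · obtain ⟨i, hi⟩ := h
      refine ⟨i, fun j hj => ?_⟩
      by_contra hjI
      exact hj (hcard j i hjI hi)
    -- If no vertex is missed, any facet will do.
    · push Not at h
      exact ⟨0, fun j _ => h j⟩
  refine ⟨S, hS, S', hS', i, (facet_subset_convexHull _ hi).trans ?_⟩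
  rw [← hI]
  exact inter_subset_right

/-- A point of the facet in the open simplex `S'` would be a limit of interior points of `S`,
against disjointness of the interiors. -/
theorem Submesh.facet_subset_iUnion {K : Submesh M} {S S' : Fin K.n} (hne : S ≠ S')
    {i : Fin (d + 1)} (h : facet (K.simplex S) i ⊆ (K.simplex S').closedInterior) :
    facet (K.simplex S) i ⊆ ⋃ j, facet (K.simplex S') j := by
  intro x hx
  refine (closedInterior_subset_interior_union _ (h hx)).resolve_left fun hxi => ?_
  have hxS := hx.1
  rw [← closure_simplex_interior] at hxS
  obtain ⟨y, hy', hy⟩ := mem_closure_iff.1 hxS _ (isOpen_simplex_interior _) hxi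
  exact (K.disjoint S S' hne).ne_of_mem hy hy' rfl

theorem Submesh.subset_iUnion_facet (K : Submesh M) {T : Fin M.nElem} {F : Set (Pt d)}
    (hF : F ⊆ frontier (M.elem T)) :
    F ⊆ ⋃ S ∈ K.inElem T, ⋃ i, facet (K.simplex S) i := by
  intro x hx
  obtain ⟨S, hS, hxS⟩ := mem_iUnion₂.1 (K.closure_elem_subset T (frontier_subset_closure (hF hx)))
  refine mem_biUnion hS ((closedInterior_subset_interior_union _ hxS).resolve_left fun hxi => ?_)
  have h1 := hF hx
  rw [(M.elem_polytope T).isOpen.frontier_eq] at h1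
  exact h1.2 (Submesh.mem_inElem.1 hS hxi)

end Submesh

/-! ### Trace and Poincaré inequality on an element -/

theorem setIntegral_le_sum {α ι : Type*} [MeasurableSpace α] {μ : Measure α} {F : Set α}
    {s : Finset ι} {σ : ι → Set α} (hF : F ⊆ ⋃ i ∈ s, σ i) {g : α → ℝ} (hg0 : ∀ x, 0 ≤ g x)
    (hg : ∀ i ∈ s, IntegrableOn g (σ i) μ) : ∫ x in F, g x ∂μ ≤ ∑ i ∈ s, ∫ x in σ i, g x ∂μ := by
  have h1 : μ.restrict F ≤ ∑ i ∈ s, μ.restrict (σ i) := by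
    refine (Measure.restrict_mono_set _ hF).trans ?_
    rw [Measure.le_iff]
    intro t ht
    rw [Measure.restrict_apply ht, Measure.coe_finsetSum, Finset.sum_apply, inter_iUnion₂]
    refine (measure_biUnion_finset_le _ _).trans (le_of_eq ?_)
    exact Finset.sum_congr rfl fun i _ => (Measure.restrict_apply ht).symm
  rw [← integral_finsetSum_measure hg]
  exact integral_mono_measure h1 (Eventually.of_forall hg0) (integrable_finsetSum_measure.2 hg)

/-- A hyperplane does not fit in a space of codimension two. If the edge from vertex `i` to vertex
`j` is parallel to it, translation along the edge changes coordinate `i` by `-1`; otherwise the line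
of the edge meets it at a point where the two coordinates sum to `1`. -/
theorem exists_bary_ne_zero_on_hyperplane {d : ℕ} [NeZero d] (S : Affine.Simplex ℝ (Pt d) d)
    {i j : Fin (d + 1)} (hij : i ≠ j) {n : Pt d} {c : ℝ} (hne : {x | inner ℝ n x = c}.Nonempty) :
    ∃ x, inner ℝ n x = c ∧ (bary S i x ≠ 0 ∨ bary S j x ≠ 0) := by
  by_contra! H
  obtain ⟨x0, hx0⟩ := hne
  rw [mem_ofPred_eq] at hx0
  by_cases h : inner ℝ n (S.points i) = inner ℝ n (S.points j)
  · have h1 := (H (x0 + (S.points j - S.points i)) (by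
      rw [inner_add_right, inner_sub_right, h, sub_self, add_zero, hx0])).1
    have h2 := (bary S i).map_vadd x0 (S.points j - S.points i)
    have h3 : (bary S i).linear (S.points j - S.points i) = -1 := by
      rw [← vsub_eq_sub, AffineMap.linearMap_vsub, bary_point, bary_point, if_pos rfl, if_neg hij]
      simp
    rw [vadd_eq_add, vadd_eq_add, h3, (H x0 hx0).1, add_comm, h1] at h2
    norm_num at h2
  · have h0 : inner ℝ n (S.points j) - inner ℝ n (S.points i) ≠ 0 := sub_ne_zero.2 (Ne.symm h)
    set s := (c - inner ℝ n (S.points i)) / (inner ℝ n (S.points j) - inner ℝ n (S.points i)) with hs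
    obtain ⟨h1, h2⟩ := H (AffineMap.lineMap (S.points i) (S.points j) s) (by
      rw [AffineMap.lineMap_apply_module', inner_add_right, inner_smul_right, inner_sub_right, hs,
        div_mul_cancel₀ _ h0]
      ring)
    rw [AffineMap.apply_lineMap, AffineMap.lineMap_apply_ring', bary_point, bary_point] at h1 h2
    simp only [if_true, hij, hij.symm, if_false] at h1 h2
    linarith

theorem Mesh.mem_facesOf {d : ℕ} {Ω : Set (Pt d)} {M : Mesh Ω} {T : Fin M.nElem}
    {F : Fin M.nFace} : F ∈ M.facesOf T ↔ M.face F ⊆ frontier (M.elem T) := by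
  simp [Mesh.facesOf]

section Faces

variable {d : ℕ} {Ω : Set (Pt d)}

theorem Mesh.face_nonempty (M : Mesh Ω) (F : Fin M.nFace) : (M.face F).Nonempty := by
  rw [nonempty_iff_ne_empty]
  intro h
  simpa [h] using M.face_pos F

theorem Mesh.isBounded_face (M : Mesh Ω) (F : Fin M.nFace) : Bornology.IsBounded (M.face F) :=
  (M.elem_polytope (M.left F)).isBounded.closure.subset
    ((M.face_left F).trans frontier_subset_closure)

theorem Mesh.measurableSet_face (M : Mesh Ω) (F : Fin M.nFace) : MeasurableSet (M.face F) := by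
  obtain ⟨n, c, U, -, hU, hF⟩ := M.face_planar F
  rw [hF]
  exact hU.measurableSet.inter (isClosed_eq (by fun_prop) continuous_const).measurableSet

end Faces

/-! ### Face diameters and number of simplices in an element -/

section Element

variable {d : ℕ} [NeZero d] {Ω : Set (Pt d)} {M : Mesh Ω} {K : Submesh M} {T : Fin M.nElem}

/-- A generic point of the face has at most one vanishing coordinate in each simplex, so it lies in
a relatively open facet; compatibility of the submesh then puts that whole open facet in the face.
-/
theorem Submesh.exists_faceOpposite_subset (K : Submesh M) (hd : 2 ≤ d) {F : Fin M.nFace}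
    (hF : M.face F ⊆ frontier (M.elem T)) :
    ∃ S ∈ K.inElem T, ∃ i x, bary (K.simplex S) i x = 0 ∧
      (∀ j, j ≠ i → 0 < bary (K.simplex S) j x) ∧
      ((K.simplex S).faceOpposite i).interior ⊆ M.face F := by
  obtain ⟨n, c, U, hn, hU, hFU⟩ := M.face_planar F
  have hne := M.face_nonempty F
  have hne' : {x | inner ℝ n x = c}.Nonempty := by
    rw [hFU] at hne; exact hne.mono inter_subset_right
  -- For every simplex and every pair of its coordinates, one of the two that does not vanish
  -- identically on the hyperplane of the face.
  choose f hf hfH using fun q : {q : Fin K.n × Fin (d + 1) × Fin (d + 1) // q.2.1 ≠ q.2.2} =>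
    show ∃ f : Pt d →ᵃ[ℝ] ℝ, (f = bary (K.simplex q.1.1) q.1.2.1 ∨
        f = bary (K.simplex q.1.1) q.1.2.2) ∧ ∃ x ∈ {x | inner ℝ n x = c}, f x ≠ 0 by
      obtain ⟨x, hx, h | h⟩ := exists_bary_ne_zero_on_hyperplane (K.simplex q.1.1) q.2 hne'
      · exact ⟨_, Or.inl rfl, x, hx, h⟩
      · exact ⟨_, Or.inr rfl, x, hx, h⟩
  obtain ⟨x, hx, hxf⟩ := exists_forall_affine_ne_zero (H := {x | inner ℝ n x = c})
    (fun x hx y hy t => by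
      rw [mem_ofPred_eq] at hx hy ⊢
      rw [AffineMap.lineMap_apply_module', inner_add_right, inner_smul_right, inner_sub_right,
        hx, hy]
      ring) hU (by rwa [inter_comm, ← hFU]) Finset.univ (f := f)
      (fun q => AffineMap.continuous_of_finiteDimensional _) (fun q _ => hfH q)
  rw [inter_comm, ← hFU] at hx
  obtain ⟨S, hS, hxS⟩ := mem_iUnion₂.1 (K.subset_iUnion_facet hF hx)
  obtain ⟨i, hxi⟩ := mem_iUnion.1 hxS
  have hpos : ∀ j, j ≠ i → 0 < bary (K.simplex S) j x := by
    intro j hj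
    refine ((mem_closedInterior_iff _).1 hxi.1 j).lt_of_ne fun h0 => ?_
    have h1 := hxf ⟨(S, j, i), hj⟩ (Finset.mem_univ _)
    rcases hf ⟨(S, j, i), hj⟩ with h | h
    · rw [h] at h1; exact h1 h0.symm
    · rw [h] at h1; exact h1 hxi.2
  refine ⟨S, hS, i, x, hxi.2, hpos, (K.face_compat S i F).resolve_left fun h => ?_⟩
  exact h.ne_of_mem (mem_faceOpposite_interior _ hd hxi.2 hpos) hx rfl

/-- The closure of the face contains the vertices of a simplex facet. There are `d ≥ 2` of them, and
two vertices of a simplex are at least its inradius apart. -/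
theorem Submesh.le_hF (K : Submesh M) (hd : 2 ≤ d) {F : Fin M.nFace}
    (hF : M.face F ⊆ frontier (M.elem T)) {r : ℝ} (hr : 0 < r)
    (hrS : ∀ S ∈ K.inElem T, r ≤ (K.simplex S).inradius) : r ≤ M.hF F := by
  obtain ⟨S, hS, i, x, hx0, hx, hsub⟩ := K.exists_faceOpposite_subset hd hF
  have hcl : ∀ j, j ≠ i → (K.simplex S).points j ∈ closure (M.face F) := by
    intro j hj
    have h1 : openSegment ℝ x ((K.simplex S).points j) ⊆ M.face F := by
      rw [openSegment_eq_image_lineMap]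
      rintro _ ⟨t, ht, rfl⟩
      refine hsub (mem_faceOpposite_interior _ hd ?_ fun l hl => ?_)
      · rw [AffineMap.apply_lineMap, AffineMap.lineMap_apply_ring', bary_point, hx0]
        simp [hj.symm]
      · rw [AffineMap.apply_lineMap, AffineMap.lineMap_apply_ring', bary_point]
        have h2 := hx l hl
        have h3 : (0 : ℝ) ≤ if l = j then 1 else 0 := by split_ifs <;> norm_num
        have h4 := mul_pos (sub_pos.2 ht.2) h2
        have h5 := mul_nonneg ht.1.le h3
        linarith
    exact closure_mono h1 (by
      rw [closure_openSegment]; exact right_mem_segment ℝ _ _)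
  obtain ⟨j, hj, l, hl, hjl⟩ : ∃ j, j ≠ i ∧ ∃ l, l ≠ i ∧ j ≠ l := by
    have h1 : 1 < (Finset.univ.erase i).card := by
      rw [Finset.card_erase_of_mem (Finset.mem_univ _)]; simp; omega
    obtain ⟨j, hj, l, hl, hjl⟩ := Finset.one_lt_card.1 h1
    exact ⟨j, Finset.ne_of_mem_erase hj, l, Finset.ne_of_mem_erase hl, hjl⟩
  refine (dist_points_ge hr (hrS S hS) hjl).trans ?_
  rw [Mesh.hF, ← Metric.diam_closure]
  exact Metric.dist_le_diam_of_mem (M.isBounded_face F).closure (hcl j hj) (hcl l hl)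

theorem Mesh.hT_pos (M : Mesh Ω) (T : Fin M.nElem) : 0 < M.hT T := by
  obtain ⟨x, hx⟩ := (M.elem_polytope T).1.nonempty
  have : Nontrivial (Pt d) := by
    have : Nonempty (Fin d) := ⟨0⟩
    infer_instance
  refine Metric.diam_pos ?_ (M.elem_polytope T).isBounded
  exact (infinite_of_mem_nhds x ((M.elem_polytope T).isOpen.mem_nhds hx)).nontrivial

theorem Submesh.norm_sub_le {S : Fin K.n} (hS : S ∈ K.inElem T) :
    ∀ x ∈ (K.simplex S).closedInterior, ∀ y ∈ (K.simplex S).closedInterior, ‖y - x‖ ≤ M.hT T := by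
  intro x hx y hy
  rw [← dist_eq_norm, Mesh.hT, ← Metric.diam_closure]
  exact Metric.dist_le_diam_of_mem (M.elem_polytope T).isBounded.closure
    (Submesh.closedInterior_subset hS hy) (Submesh.closedInterior_subset hS hx)

/-- The simplices are disjoint and each contains a ball of radius comparable to `h_T`, while the
element lies in a ball of radius `h_T`. -/
theorem Submesh.card_inElem_le {κ : ℝ} (hκ : 0 < κ)
    (hrS : ∀ S ∈ K.inElem T, κ * M.hT T ≤ (K.simplex S).inradius) :
    ((K.inElem T).card : ℝ) ≤ (2 * (d + 1) / κ) ^ d := by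
  have hh := M.hT_pos T
  have hω := unitVol_pos d
  set δ := κ * M.hT T / (2 * (d + 1)) with hδ
  have hδ0 : 0 < δ := by positivity
  have h1 : ∀ S ∈ K.inElem T, δ ^ d * unitVol d ≤ volume.real (K.simplex S).interior := by
    intro S hS
    obtain ⟨x0, hx0⟩ := exists_inner_ball (mul_pos hκ hh) (hrS S hS)
    have h2 : volume.real (Metric.closedBall x0 δ) = δ ^ d * unitVol d := by
      rw [measureReal_def, volume_closedBall_eq _ hδ0.le, ENNReal.toReal_ofReal (by positivity)]
    rw [← h2]
    refine measureReal_mono (fun x hx => (mem_interior_iff _).2 fun i =>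
      lt_of_lt_of_le (by positivity) (hx0 x hx i)) ?_
    exact ne_top_of_le_ne_top (K.simplex S).isCompact_closedInterior.measure_lt_top.ne
      (measure_mono (K.simplex S).interior_subset_closedInterior)
  obtain ⟨x, hx⟩ := (M.elem_polytope T).1.nonempty
  have h3 : volume.real (M.elem T) ≤ M.hT T ^ d * unitVol d := by
    rw [← ENNReal.toReal_ofReal (show 0 ≤ M.hT T ^ d * unitVol d by positivity),
      ← volume_closedBall_eq x hh.le]
    refine measureReal_mono (fun y hy => ?_) (isCompact_closedBall x _).measure_lt_top.ne
    exact Metric.dist_le_diam_of_mem (M.elem_polytope T).isBounded hy hx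
  have h4 : (K.inElem T).card * (δ ^ d * unitVol d) ≤ M.hT T ^ d * unitVol d := by
    rw [← nsmul_eq_mul]
    refine (Finset.card_nsmul_le_sum _ _ _ h1).trans (le_trans ?_ h3)
    rw [← measureReal_biUnion_finset (fun S _ S' _ hne => K.disjoint S S' hne)
      (fun S _ => (isOpen_simplex_interior _).measurableSet) fun S hS =>
        ne_top_of_le_ne_top (volume_lt_top (M.elem_polytope T))
          (measure_mono (Submesh.mem_inElem.1 hS))]
    exact measureReal_mono (iUnion₂_subset fun S hS => Submesh.mem_inElem.1 hS)
      (volume_lt_top (M.elem_polytope T))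
  have h5 : M.hT T ^ d * unitVol d = (2 * (d + 1) / κ) ^ d * (δ ^ d * unitVol d) := by
    rw [hδ, ← mul_assoc, ← mul_pow]
    congr 2
    field_simp
  rw [h5] at h4
  exact le_of_mul_le_mul_right h4 (by positivity)

end Element

/-! ### Chaining the simplex constants across an element -/

section ElementInequality

variable {d : ℕ} [NeZero d] {Ω : Set (Pt d)} {M : Mesh Ω} {K : Submesh M} {T : Fin M.nElem}

theorem setIntegral_closedInterior_le {S : Fin K.n} (hS : S ∈ K.inElem T) {g : Pt d → ℝ}
    (hg : Continuous g) (hg0 : ∀ x, 0 ≤ g x) :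
    ∫ x in (K.simplex S).closedInterior, g x ≤ ∫ x, g x ∂(M.vol T) := by
  have h1 : ((K.simplex S).interior : Set (Pt d)) =ᵐ[volume] (K.simplex S).closedInterior := by
    rw [interior_eq_interior]
    exact interior_ae_eq_of_null_frontier ((closedInterior_convex _).addHaar_frontier volume)
  rw [← setIntegral_congr_set h1]
  exact setIntegral_mono_set (M.integrable_vol T hg) (Eventually.of_forall hg0)
    (Submesh.mem_inElem.1 hS).eventuallyLE

/-- Both constants approximate `w` in `L²` of the common facet, so the triangle inequality compares
them there; `4 = 2 + 2` comes from squaring. -/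
theorem sq_sub_mul_le {S S' : Fin K.n} (hne : S ≠ S') {i : Fin (d + 1)}
    (hsub : facet (K.simplex S) i ⊆ (K.simplex S').closedInterior) {w : Pt d → ℝ}
    (hw : Continuous w) {a a' Q : ℝ}
    (h : ∑ i, ∫ x, (w x - a) ^ 2 ∂(surf (facet (K.simplex S) i)) ≤ Q)
    (h' : ∑ i, ∫ x, (w x - a') ^ 2 ∂(surf (facet (K.simplex S') i)) ≤ Q) :
    (a - a') ^ 2 * (surf (facet (K.simplex S) i)).real univ ≤ 4 * Q := by
  have h1 : ∫ x, (w x - a) ^ 2 ∂(surf (facet (K.simplex S) i)) ≤ Q :=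
    (Finset.single_le_sum (f := fun i => ∫ x, (w x - a) ^ 2 ∂(surf (facet (K.simplex S) i)))
      (fun i _ => integral_nonneg fun x => sq_nonneg _) (Finset.mem_univ i)).trans h
  -- The facet of `S` is only known to be covered by the facets of `S'`, so all of them enter the
  -- bound.
  have h2 : ∫ x, (w x - a') ^ 2 ∂(surf (facet (K.simplex S) i)) ≤ Q := by
    refine (setIntegral_le_sum (s := Finset.univ) (σ := fun j => facet (K.simplex S') j) ?_
      (fun x => sq_nonneg _) fun j _ => ?_).trans h'
    · simpa using Submesh.facet_subset_iUnion hne hsub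
    · exact integrable_facet j (by fun_prop)
  have hi : ∀ b, Integrable (fun x => (w x - b) ^ 2) (surf (facet (K.simplex S) i)) := fun b =>
    integrable_facet i (by fun_prop)
  calc (a - a') ^ 2 * (surf (facet (K.simplex S) i)).real univ
      = ∫ _, (a - a') ^ 2 ∂(surf (facet (K.simplex S) i)) := by
        rw [integral_const, smul_eq_mul, mul_comm]
    _ ≤ ∫ x, (2 * (w x - a) ^ 2 + 2 * (w x - a') ^ 2) ∂(surf (facet (K.simplex S) i)) := by
        refine integral_mono (integrable_facet i continuous_const)
          (((hi a).const_mul 2).add ((hi a').const_mul 2)) fun x => ?_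
        change (a - a') ^ 2 ≤ 2 * (w x - a) ^ 2 + 2 * (w x - a') ^ 2
        nlinarith [sq_nonneg ((w x - a) + (w x - a'))]
    _ ≤ 4 * Q := by
        rw [integral_add ((hi a).const_mul 2) ((hi a').const_mul 2), integral_const_mul,
          integral_const_mul]
        linarith

theorem sum_faces_integral_le {g : Pt d → ℝ} (hg : Continuous g) (hg0 : ∀ x, 0 ≤ g x) :
    ∑ F ∈ M.facesOf T, ∫ x, g x ∂(M.area F)
      ≤ ∑ S ∈ K.inElem T, ∑ i, ∫ x, g x ∂(surf (facet (K.simplex S) i)) := by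
  have h1 := integral_biUnion_finset (μ := (Measure.euclideanHausdorffMeasure (d - 1) : Measure (Pt d)))
    (f := g) (M.facesOf T) (fun F _ => M.measurableSet_face F)
    (fun F _ F' _ h => M.face_disjoint F F' h) (fun F _ => M.integrable_area F hg)
  have h2 := setIntegral_le_sum (μ := (Measure.euclideanHausdorffMeasure (d - 1) : Measure (Pt d)))
    (F := ⋃ F ∈ M.facesOf T, M.face F)
    (s := (K.inElem T).sigma fun _ => (Finset.univ : Finset (Fin (d + 1))))
    (σ := fun q => facet (K.simplex q.1) q.2) (g := g) (fun x hx => by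
      obtain ⟨F, hF, hxF⟩ := mem_iUnion₂.1 hx
      obtain ⟨S, hS, hxS⟩ := mem_iUnion₂.1 (K.subset_iUnion_facet (Mesh.mem_facesOf.1 hF) hxF)
      obtain ⟨i, hi⟩ := mem_iUnion.1 hxS
      exact mem_iUnion₂.2 ⟨⟨S, i⟩, by simpa using hS, hi⟩) hg0
    fun q _ => integrable_facet _ hg
  rw [h1, Finset.sum_sigma] at h2
  exact h2

/-- Two simplices of the element `T` are adjacent if one has a facet contained in the other. -/
def facetGraph (K : Submesh M) (T : Fin M.nElem) : SimpleGraph {S // S ∈ K.inElem T} :=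
  SimpleGraph.fromRel fun S S' =>
    ∃ i, facet (K.simplex S.1) i ⊆ (K.simplex S'.1).closedInterior

/-- The simplices reachable from `S0` and the others would split the element into two nonempty
families; `Submesh.exists_facet_subset` supplies an edge between them. -/
theorem facetGraph_preconnected : (facetGraph K T).Preconnected := by
  classical
  intro S0 S1
  by_contra hR
  let A : Finset (Fin K.n) :=
    (Finset.univ.filter fun S => (facetGraph K T).Reachable S0 S).image Subtype.val
  let B : Finset (Fin K.n) :=
    (Finset.univ.filter fun S => ¬ (facetGraph K T).Reachable S0 S).image Subtype.val
  have hA : ∀ S : {S // S ∈ K.inElem T}, S.1 ∈ A ↔ (facetGraph K T).Reachable S0 S := by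
    simp [A]
  have hB : ∀ S : {S // S ∈ K.inElem T}, S.1 ∈ B ↔ ¬ (facetGraph K T).Reachable S0 S := by
    simp [B]
  have hAT : A ⊆ K.inElem T := by
    intro S hS
    obtain ⟨S', -, rfl⟩ := Finset.mem_image.1 hS
    exact S'.2
  have hBT : B ⊆ K.inElem T := by
    intro S hS
    obtain ⟨S', -, rfl⟩ := Finset.mem_image.1 hS
    exact S'.2
  obtain ⟨S, hS, S', hS', i, hi⟩ := K.exists_facet_subset T (A := A) (B := B)
    ⟨S0, (hA S0).2 (SimpleGraph.Reachable.refl _)⟩ ⟨S1, (hB S1).2 hR⟩ hAT hBT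
    (fun S hS => by
      by_cases h : (facetGraph K T).Reachable S0 ⟨S, hS⟩
      · exact Finset.mem_union_left _ ((hA ⟨S, hS⟩).2 h)
      · exact Finset.mem_union_right _ ((hB ⟨S, hS⟩).2 h))
    (Finset.disjoint_left.2 fun S hS hS' => (hB ⟨S, hAT hS⟩).1 hS' ((hA ⟨S, hAT hS⟩).1 hS))
  have h1 := (hA ⟨S, hAT hS⟩).1 hS
  have h2 := (hB ⟨S', hBT hS'⟩).1 hS'
  refine h2 (h1.trans (SimpleGraph.Adj.reachable ?_))
  refine (SimpleGraph.fromRel_adj _ _ _).2 ⟨fun h => h2 (h ▸ h1), Or.inl ⟨i, hi⟩⟩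

theorem abs_sub_le_length_mul {V : Type*} {G : SimpleGraph V} {a : V → ℝ} {D : ℝ}
    (h : ∀ u v, G.Adj u v → |a u - a v| ≤ D) {u v : V} (p : G.Walk u v) :
    |a u - a v| ≤ p.length * D := by
  induction p with
  | nil => simp
  | cons hadj p ih =>
    have h1 := abs_sub_le (a _) (a _) (a _) |>.trans (add_le_add (h _ _ hadj) ih)
    simpa [add_mul, add_comm] using h1

/-- Bound on the number of simplices of the submesh in an element. -/
def cardConst (d : ℕ) (κ : ℝ) : ℝ := (2 * (d + 1) / κ) ^ d

/-- The constant of the trace and Poincaré inequality on an element. -/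
def elemConst (d : ℕ) (κ : ℝ) : ℝ :=
  cardConst d κ * traceConst d κ * (2 + 8 * (d + 1) * cardConst d κ ^ 2 * (d / κ) ^ (d - 1)) / κ

/-- Each simplex has its own constant, and a shared facet of area at least `s0` limits the change
between neighbours to `D`. A path in the facet graph has at most as many steps as there are
simplices, so the constant of one fixed simplex serves the whole element. -/
theorem exists_sum_faces_le (hd : 2 ≤ d) {κ : ℝ} (hκ : 0 < κ)
    (hrS : ∀ S ∈ K.inElem T, κ * M.hT T ≤ (K.simplex S).inradius) {w : Pt d → ℝ}
    (hw : ContDiff ℝ 1 w) :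
    ∃ a : ℝ, ∑ F ∈ M.facesOf T, (M.hF F)⁻¹ * ∫ x, (w x - a) ^ 2 ∂(M.area F)
      ≤ elemConst d κ * ∫ x, ‖fderiv ℝ w x‖ ^ 2 ∂(M.vol T) := by
  have hh := M.hT_pos T
  have hω := unitVol_pos (d - 1)
  have hd0 : (0 : ℝ) < d := Nat.cast_pos.2 (NeZero.pos d)
  have hC1 := traceConst_pos d hκ
  have hN0 : 0 < cardConst d κ := by unfold cardConst; positivity
  have hwc := hw.continuous
  have hdw : Continuous fun x => ‖fderiv ℝ w x‖ ^ 2 :=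
    (hw.continuous_fderiv (by norm_num)).norm.pow 2
  obtain ⟨G, hG⟩ : ∃ G, G = ∫ x, ‖fderiv ℝ w x‖ ^ 2 ∂(M.vol T) := ⟨_, rfl⟩
  rw [← hG]
  have hG0 : 0 ≤ G := hG ▸ integral_nonneg fun x => by positivity
  obtain ⟨Q, hQ⟩ : ∃ Q, Q = traceConst d κ * M.hT T * G := ⟨_, rfl⟩
  have hQ0 : 0 ≤ Q := by rw [hQ]; positivity
  have hex : ∀ S : {S // S ∈ K.inElem T}, ∃ a : ℝ,
      ∑ i, ∫ x, (w x - a) ^ 2 ∂(surf (facet (K.simplex S.1) i)) ≤ Q := by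
    intro S
    obtain ⟨a, ha⟩ := exists_sum_facet_le hκ hh (hrS S.1 S.2) (Submesh.norm_sub_le S.2) hw
    refine ⟨a, ha.trans ?_⟩
    rw [hQ, hG]
    exact mul_le_mul_of_nonneg_left
      (setIntegral_closedInterior_le S.2 hdw fun x => by positivity) (by positivity)
  choose a ha using hex
  obtain ⟨s0, hs0⟩ : ∃ s0, s0 = (κ * M.hT T / d) ^ (d - 1) * unitVol (d - 1) := ⟨_, rfl⟩
  have hs0p : 0 < s0 := by rw [hs0]; positivity
  obtain ⟨D, hD⟩ : ∃ D, D = Real.sqrt (4 * Q / s0) := ⟨_, rfl⟩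
  have hD2 : D ^ 2 = 4 * Q / s0 := hD ▸ Real.sq_sqrt (by positivity)
  have hstep : ∀ S S' : {S // S ∈ K.inElem T}, S ≠ S' →
      (∃ i, facet (K.simplex S.1) i ⊆ (K.simplex S'.1).closedInterior) → |a S - a S'| ≤ D := by
    rintro S S' hne ⟨i, hi⟩
    rw [hD]
    refine Real.abs_le_sqrt ?_
    rw [le_div_iff₀ hs0p]
    refine le_trans ?_ (sq_sub_mul_le (fun h => hne (Subtype.ext h)) hi hwc (ha S) (ha S'))
    rw [hs0]
    gcongr
    rw [measureReal_def, ← ENNReal.ofReal_le_iff_le_toReal (surf_facet_ne_top i)]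
    exact le_surf_facet (by positivity) (hrS S.1 S.2) i
  have hadj : ∀ S S', (facetGraph K T).Adj S S' → |a S - a S'| ≤ D := by
    intro S S' h
    obtain ⟨hne, h | h⟩ := (SimpleGraph.fromRel_adj _ _ _).1 h
    · exact hstep S S' hne h
    · rw [abs_sub_comm]; exact hstep S' S hne.symm h
  have hcard : ((K.inElem T).card : ℝ) ≤ cardConst d κ := Submesh.card_inElem_le hκ hrS
  obtain ⟨S0⟩ : Nonempty {S // S ∈ K.inElem T} := by
    obtain ⟨x, hx⟩ := (M.elem_polytope T).1.nonempty
    obtain ⟨S, hS, -⟩ := mem_iUnion₂.1 (K.closure_elem_subset T (subset_closure hx))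
    exact ⟨⟨S, hS⟩⟩
  have hdiff : ∀ S, (a S - a S0) ^ 2 ≤ cardConst d κ ^ 2 * (4 * Q / s0) := by
    classical
    intro S
    obtain ⟨p⟩ := facetGraph_preconnected (K := K) (T := T) S S0
    have h1 := abs_sub_le_length_mul hadj (p.toPath : (facetGraph K T).Walk S S0)
    have h2 : (((p.toPath : (facetGraph K T).Walk S S0).length : ℕ) : ℝ) ≤ cardConst d κ := by
      refine le_trans ?_ hcard
      -- A path repeats no vertex, hence is shorter than the number of simplices.
      have h3 := p.toPath.2.length_lt
      rw [Fintype.card_coe] at h3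
      exact_mod_cast h3.le
    rw [← hD2, ← mul_pow, ← sq_abs]
    gcongr
    exact h1.trans (mul_le_mul_of_nonneg_right h2 (hD ▸ Real.sqrt_nonneg _))
  have hfacet : ∀ (S : {S // S ∈ K.inElem T}) (i : Fin (d + 1)),
      (surf (facet (K.simplex S.1) i)).real univ ≤ M.hT T ^ (d - 1) * unitVol (d - 1) := fun S i =>
    ENNReal.toReal_le_of_le_ofReal (by positivity) (surf_facet_le (Submesh.norm_sub_le S.2) i)
  have hS : ∀ S : {S // S ∈ K.inElem T},
      ∑ i, ∫ x, (w x - a S0) ^ 2 ∂(surf (facet (K.simplex S.1) i))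
        ≤ 2 * Q + 8 * (d + 1) * cardConst d κ ^ 2 * (d / κ) ^ (d - 1) * Q := by
    intro S
    have hi : ∀ b i, Integrable (fun x => (w x - b) ^ 2) (surf (facet (K.simplex S.1) i)) :=
      fun b i => integrable_facet i (by fun_prop)
    have h1 : ∀ i, ∫ x, (w x - a S0) ^ 2 ∂(surf (facet (K.simplex S.1) i))
        ≤ 2 * ∫ x, (w x - a S) ^ 2 ∂(surf (facet (K.simplex S.1) i))
          + 8 * cardConst d κ ^ 2 * (d / κ) ^ (d - 1) * Q := by
      intro i
      calc _ ≤ ∫ x, (2 * (w x - a S) ^ 2 + 2 * (a S - a S0) ^ 2)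
            ∂(surf (facet (K.simplex S.1) i)) := by
            refine integral_mono (hi _ i) (((hi _ i).const_mul 2).add
              (integrable_facet i continuous_const)) fun x => ?_
            change (w x - a S0) ^ 2 ≤ 2 * (w x - a S) ^ 2 + 2 * (a S - a S0) ^ 2
            nlinarith [sq_nonneg ((w x - a S) - (a S - a S0))]
        _ ≤ _ := by
            rw [integral_add ((hi _ i).const_mul 2) (integrable_facet i continuous_const),
              integral_const_mul, integral_const, smul_eq_mul]
            refine add_le_add le_rfl ?_
            -- The ratio of the upper to the lower bound for facet areas is `(d/κ)^(d-1)`,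
            -- independent of `h_T`.
            calc _ ≤ (M.hT T ^ (d - 1) * unitVol (d - 1)) *
                  (2 * (cardConst d κ ^ 2 * (4 * Q / s0))) := by
                  gcongr
                  · exact hfacet S i
                  · exact hdiff S
              _ = _ := by
                  rw [hs0, div_pow, mul_pow, div_pow]
                  field_simp
                  ring
    calc _ ≤ ∑ i, (2 * ∫ x, (w x - a S) ^ 2 ∂(surf (facet (K.simplex S.1) i))
          + 8 * cardConst d κ ^ 2 * (d / κ) ^ (d - 1) * Q) := Finset.sum_le_sum fun i _ => h1 i
      _ ≤ _ := by
          rw [Finset.sum_add_distrib, ← Finset.mul_sum, Finset.sum_const, Finset.card_univ,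
            Fintype.card_fin, nsmul_eq_mul]
          have := ha S
          push_cast
          nlinarith
  refine ⟨a S0, ?_⟩
  -- Face diameters are bounded below by `κ h_T`; this cancels the factor `h_T` in `Q`.
  have hF : ∀ F ∈ M.facesOf T, (M.hF F)⁻¹ * ∫ x, (w x - a S0) ^ 2 ∂(M.area F)
      ≤ (κ * M.hT T)⁻¹ * ∫ x, (w x - a S0) ^ 2 ∂(M.area F) := by
    intro F hF
    have h1 := K.le_hF hd (Mesh.mem_facesOf.1 hF) (by positivity) hrS
    have h2 : 0 ≤ ∫ x, (w x - a S0) ^ 2 ∂(M.area F) := integral_nonneg fun x => sq_nonneg _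
    gcongr
  have hU := sum_faces_integral_le (K := K) (T := T) (g := fun x => (w x - a S0) ^ 2)
    (by fun_prop) fun x => sq_nonneg _
  calc _ ≤ (κ * M.hT T)⁻¹ * ∑ F ∈ M.facesOf T, ∫ x, (w x - a S0) ^ 2 ∂(M.area F) := by
        rw [Finset.mul_sum]; exact Finset.sum_le_sum hF
    _ ≤ (κ * M.hT T)⁻¹ * (cardConst d κ *
          (2 * Q + 8 * (d + 1) * cardConst d κ ^ 2 * (d / κ) ^ (d - 1) * Q)) := by
        gcongr
        refine hU.trans ((Finset.sum_le_card_nsmul _ _ _ fun S hS' => hS ⟨S, hS'⟩).trans ?_)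
        rw [nsmul_eq_mul]
        gcongr
    _ = _ := by
        rw [elemConst, hQ]
        field_simp

end ElementInequality

/-! ### Elements and faces of a mesh -/

section MeshGeometry

variable {d : ℕ} {Ω : Set (Pt d)}

/-- A polytope is the interior of a closed set, hence regular open. This places the elements in `Ω`
itself and not merely in its closure. -/
theorem IsPolytope.interior_closure (h : IsPolytope Ω) : interior (closure Ω) = Ω := by
  refine Subset.antisymm ?_ (interior_maximal subset_closure h.isOpen)
  obtain ⟨-, n, S, rfl⟩ := h
  exact interior_mono (closure_minimal interior_subset
    (isClosed_iUnion_of_finite fun i => (S i).isClosed_closedInterior))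

theorem Mesh.elem_subset (M : Mesh Ω) (hΩ : IsPolytope Ω) (T : Fin M.nElem) : M.elem T ⊆ Ω := by
  refine Subset.trans (interior_maximal (subset_closure.trans ?_) (M.elem_polytope T).isOpen)
    hΩ.interior_closure.subset
  rw [M.elem_cover]
  exact subset_iUnion (fun T => closure (M.elem T)) T

/-- The face is relatively open in its hyperplane, so it contains a small displacement in each
tangential direction; `n` is orthogonal to all of these and therefore parallel to `n₀`. -/
theorem IsOuterNormal.eq_or_eq_neg {T F : Set (Pt d)} {n n₀ : Pt d} {c : ℝ} {U : Set (Pt d)}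
    (h : IsOuterNormal T F n) (hn₀ : n₀ ≠ 0) (hU : IsOpen U) (hF : F = U ∩ {x | inner ℝ n₀ x = c})
    (hne : F.Nonempty) : n = ‖n₀‖⁻¹ • n₀ ∨ n = -(‖n₀‖⁻¹ • n₀) := by
  obtain ⟨x, hx⟩ := hne
  have h1 : n ∈ (ℝ ∙ n₀)ᗮᗮ := by
    rw [Submodule.mem_orthogonal']
    intro v hv
    rw [Submodule.mem_orthogonal_singleton_iff_inner_right] at hv
    have hx' := hx
    rw [hF] at hx'
    have hl : Continuous fun t : ℝ => x + t • v := by fun_prop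
    have h2 : ∀ᶠ t in 𝓝[≠] (0 : ℝ), x + t • v ∈ U :=
      (hl.continuousAt.eventually (hU.mem_nhds (by simpa using hx'.1))).filter_mono
        nhdsWithin_le_nhds
    obtain ⟨t, ht, ht0⟩ := (h2.and self_mem_nhdsWithin).exists
    have h3 : x + t • v ∈ F := by
      rw [hF]
      refine ⟨ht, ?_⟩
      rw [mem_ofPred_eq, inner_add_right, inner_smul_right, hv, mul_zero, add_zero]
      exact hx'.2
    have h4 := h.orthogonal _ h3 _ hx
    rw [add_sub_cancel_left, inner_smul_right] at h4
    exact (mul_eq_zero.1 h4).resolve_left ht0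
  rw [Submodule.orthogonal_orthogonal, Submodule.mem_span_singleton] at h1
  obtain ⟨t, rfl⟩ := h1
  have hn : 0 < ‖n₀‖ := norm_pos_iff.2 hn₀
  have h2 := h.unit
  rw [norm_smul, Real.norm_eq_abs] at h2
  have h3 : |t| = ‖n₀‖⁻¹ := eq_inv_of_mul_eq_one_left h2
  rcases abs_choice t with h | h
  · left; rw [← h3, h]
  · right; rw [← h3, h, neg_smul, neg_neg]

/-- Two elements with the same outward normal on the face would both contain `x - t n` for small
`t`, against disjointness; only two unit normals are available. -/
theorem Mesh.card_elems_le_two (M : Mesh Ω) (F : Fin M.nFace) :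
    (Finset.univ.filter fun T => F ∈ M.facesOf T).card ≤ 2 := by
  classical
  obtain ⟨n₀, c, U, hn₀, hU, hF⟩ := M.face_planar F
  have hsurf : NeZero (surf (M.face F)) := ⟨fun h => by
    have := M.face_pos F
    rw [h] at this
    simp at this⟩
  have hne := M.face_nonempty F
  refine (Finset.card_le_card_of_injOn (fun T => M.normal T F)
    (t := {‖n₀‖⁻¹ • n₀, -(‖n₀‖⁻¹ • n₀)}) ?_ ?_).trans Finset.card_le_two
  · intro T hT
    have hT' : F ∈ M.facesOf T := by simpa using hT
    have h := (M.normal_spec T F (by simpa [Mesh.facesOf] using hT')).eq_or_eq_neg hn₀ hU hF hne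
    simpa using h
  · intro T hT T' hT' heq
    have h1 : F ∈ M.facesOf T := by simpa using hT
    have h2 : F ∈ M.facesOf T' := by simpa using hT'
    have h3 := (M.normal_spec T F (by simpa [Mesh.facesOf] using h1)).outward
    have h4 := (M.normal_spec T' F (by simpa [Mesh.facesOf] using h2)).outward
    obtain ⟨x, hx, hx'⟩ := (h3.and h4).exists
    obtain ⟨t, ht, ht'⟩ := (hx.and hx').exists
    by_contra hTT
    change M.normal T F = M.normal T' F at heq
    rw [← heq] at ht'
    exact (M.elem_disjoint T T' hTT).ne_of_mem ht.1 ht'.1 rfl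

theorem Mesh.sum_facesOf_le (M : Mesh Ω) {A : Fin M.nFace → ℝ} (hA : ∀ F, 0 ≤ A F) :
    ∑ T, ∑ F ∈ M.facesOf T, A F ≤ 2 * ∑ F, A F := by
  rw [Finset.sum_comm' (t' := Finset.univ)
    (s' := fun F => Finset.univ.filter fun T => F ∈ M.facesOf T) (by simp), Finset.mul_sum]
  refine Finset.sum_le_sum fun F _ => ?_
  rw [Finset.sum_const, nsmul_eq_mul]
  exact mul_le_mul_of_nonneg_right (by exact_mod_cast M.card_elems_le_two F) (hA F)

theorem Mesh.sum_faces_le (M : Mesh Ω) {X : Fin M.nElem → Fin M.nFace → ℝ}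
    (hX : ∀ T F, 0 ≤ X T F) {e : Fin M.nFace → Fin M.nElem} (he : ∀ F, F ∈ M.facesOf (e F)) :
    ∑ F, X (e F) F ≤ ∑ T, ∑ F ∈ M.facesOf T, X T F := by
  rw [Finset.sum_comm' (t' := Finset.univ)
    (s' := fun F => Finset.univ.filter fun T => F ∈ M.facesOf T) (by simp)]
  exact Finset.sum_le_sum fun F _ => Finset.single_le_sum (f := fun T => X T F)
    (fun T _ => hX T F) (by simpa using he F)

end MeshGeometry

/-! ### Derivatives of polynomials -/

section PolyDeriv

variable {d : ℕ}

theorem contDiff_pev (P : Poly d) : ContDiff ℝ ∞ (pev P) := by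
  have h : ∀ i : Fin d, ContDiff ℝ ∞ fun x : Pt d => x i := fun i =>
    (EuclideanSpace.proj (𝕜 := ℝ) i).contDiff
  induction P using MvPolynomial.induction_on with
  | C a =>
    have : pev (MvPolynomial.C a : Poly d) = fun _ => a := by ext; simp [pev]
    rw [this]; exact contDiff_const
  | add P Q hP hQ =>
    have : pev (P + Q) = fun x => pev P x + pev Q x := by ext; simp
    rw [this]; exact hP.add hQ
  | mul_X P i hP =>
    have : pev (P * MvPolynomial.X i) = fun x => pev P x * x i := by ext; simp [pev]
    rw [this]; exact hP.mul (h i)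

theorem fderiv_pev (P : Poly d) (x : Pt d) (j : Fin d) :
    fderiv ℝ (pev P) x (EuclideanSpace.single j 1) = pev (MvPolynomial.pderiv j P) x := by
  have hd : ∀ P : Poly d, DifferentiableAt ℝ (pev P) x := fun P =>
    (contDiff_pev P).differentiable (by simp) x
  induction P using MvPolynomial.induction_on with
  | C a =>
    have : pev (MvPolynomial.C a : Poly d) = fun _ => a := by ext; simp [pev]
    rw [this]; simp [pev]
  | add P Q hP hQ =>
    have : pev (P + Q) = pev P + pev Q := by ext; simp
    rw [this, fderiv_add (hd P) (hd Q), add_apply, hP, hQ, map_add, pev_add]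
  | mul_X P i hP =>
    have : pev (P * MvPolynomial.X i) = pev P * fun x => EuclideanSpace.proj (𝕜 := ℝ) i x := by
      ext; simp [pev]
    rw [this, fderiv_mul (hd P) (ContinuousLinearMap.differentiableAt _), Derivation.leibniz,
      add_apply, smul_apply,
      smul_apply, hP, ContinuousLinearMap.fderiv]
    simp [pev, MvPolynomial.pderiv_X, Pi.single_apply, mul_comm]
    by_cases h : i = j <;> simp [h]

theorem norm_sq_le_sum (L : Pt d →L[ℝ] ℝ) :
    ‖L‖ ^ 2 ≤ ∑ j, L (EuclideanSpace.single j 1) ^ 2 := by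
  have h1 : ‖L‖ ≤ Real.sqrt (∑ j, L (EuclideanSpace.single j 1) ^ 2) := by
    refine L.opNorm_le_bound (Real.sqrt_nonneg _) fun x => ?_
    have h2 : L x = ∑ j, L (EuclideanSpace.single j 1) * x j := by
      conv_lhs => rw [← (EuclideanSpace.basisFun (Fin d) ℝ).sum_repr x]
      simp [mul_comm]
    rw [h2, Real.norm_eq_abs, EuclideanSpace.norm_eq, ← Real.sqrt_mul (by positivity)]
    refine Real.abs_le_sqrt ?_
    simpa using Finset.sum_mul_sq_le_sq_mul_sq Finset.univ
      (fun j => L (EuclideanSpace.single j 1)) fun j => x j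
  calc _ ≤ Real.sqrt (∑ j, L (EuclideanSpace.single j 1) ^ 2) ^ 2 := by gcongr
    _ = _ := Real.sq_sqrt (Finset.sum_nonneg fun j _ => sq_nonneg _)

end PolyDeriv

/-! ### The jump on a face -/

section Jump

variable {d : ℕ} {Ω : Set (Pt d)} {M : Mesh Ω} {k : ℕ}

theorem DiscVel.isL2Proj_deltaTF (v : DiscVel M k) (T : Fin M.nElem) (F : Fin M.nFace) (i : Fin d) :
    IsL2Proj (M.area F) k (fun x => pev (v.velRec T i) x - pev (v.face F i) x) (v.deltaTF T F i) :=
  isL2Proj_l2Proj (fun _ hg => M.integrable_area F hg) k fun P => M.integrable_area F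
    (((continuous_pev _).sub (continuous_pev _)).mul (continuous_pev P))

/-- Pythagoras: constants have degree at most `k` for every `k ≥ 0`, so the projection error is
orthogonal to `P - c`. -/
theorem integral_sq_sub_proj_le (F : Fin M.nFace) {g : Pt d → ℝ} (hg : Continuous g) {P : Poly d}
    (hP : IsL2Proj (M.area F) k g P) (c : ℝ) :
    ∫ x, (g x - pev P x) ^ 2 ∂(M.area F) ≤ ∫ x, (g x - c) ^ 2 ∂(M.area F) := by
  have hPc := continuous_pev P
  have h1 := hP.2 (P - MvPolynomial.C c) (Submodule.sub_mem _ hP.1 (by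
    rw [MvPolynomial.mem_restrictTotalDegree]; simp))
  have h2 : ∀ x, pev (P - MvPolynomial.C c) x = pev P x - c := fun x => by simp [pev]
  simp only [h2] at h1
  have h3 : ∀ x, (g x - c) ^ 2 = (g x - pev P x) ^ 2 + (pev P x - c) ^ 2
      - 2 * ((pev P x - g x) * (pev P x - c)) := fun x => by ring
  simp only [h3]
  rw [integral_sub (M.integrable_area F (by fun_prop)) (M.integrable_area F (by fun_prop)),
    integral_add (M.integrable_area F (by fun_prop)) (M.integrable_area F (by fun_prop)),
    integral_const_mul, h1, mul_zero, sub_zero]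
  exact le_add_of_nonneg_right (integral_nonneg fun x => sq_nonneg _)

theorem integral_sq_sub_le (F : Fin M.nFace) {g₁ g₂ : Pt d → ℝ} (h₁ : Continuous g₁)
    (h₂ : Continuous g₂) :
    ∫ x, (g₁ x - g₂ x) ^ 2 ∂(M.area F)
      ≤ 2 * ∫ x, g₁ x ^ 2 ∂(M.area F) + 2 * ∫ x, g₂ x ^ 2 ∂(M.area F) := by
  rw [← integral_const_mul, ← integral_const_mul,
    ← integral_add (M.integrable_area F (by fun_prop)) (M.integrable_area F (by fun_prop))]
  refine integral_mono (M.integrable_area F (by fun_prop)) (M.integrable_area F (by fun_prop))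
    fun x => ?_
  change (g₁ x - g₂ x) ^ 2 ≤ 2 * g₁ x ^ 2 + 2 * g₂ x ^ 2
  nlinarith [sq_nonneg (g₁ x + g₂ x)]

theorem integral_sq_le_proj (F : Fin M.nFace) {g : Pt d → ℝ} (hg : Continuous g) {P : Poly d}
    (hP : IsL2Proj (M.area F) k g P) (c : ℝ) :
    ∫ x, g x ^ 2 ∂(M.area F)
      ≤ 2 * ∫ x, pev P x ^ 2 ∂(M.area F) + 2 * ∫ x, (g x - c) ^ 2 ∂(M.area F) := by
  have hPc := continuous_pev P
  have h1 := integral_sq_sub_le F (g₂ := fun x => pev P x - g x) hPc (hPc.sub hg)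
  have h2 : ∀ x, (pev P x - (pev P x - g x)) ^ 2 = g x ^ 2 := fun x => by ring
  have h3 : ∀ x, (pev P x - g x) ^ 2 = (g x - pev P x) ^ 2 := fun x => by ring
  simp only [h2, h3] at h1
  linarith [integral_sq_sub_proj_le F hg hP c]

/-- The projection of the jump involves only the `δ_TF`, since the face unknown cancels or vanishes.
The rest is at most the distance to a constant, in which `φ` is inserted at no cost because it is
continuous across interfaces and zero on the boundary. The factor `4` comes from two uses of `(a -
b)² ≤ 2a² + 2b²`. -/
theorem integral_jump_sq_le (hΩ : IsOpen Ω) {uh : DiscVel M k} (hb : uh.VanishesOnBoundary)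
    {φ : Pt d → ℝ} (hφ : IsTestFun Ω φ) (F : Fin M.nFace) (i : Fin d) (a : Fin M.nElem → ℝ) :
    ∫ x, jump M uh.velRec F i x ^ 2 ∂(M.area F)
      ≤ 4 * ((∫ x, pev (uh.deltaTF (M.left F) F i) x ^ 2 ∂(M.area F))
          + ∫ x, pev (uh.deltaTF (M.right F) F i) x ^ 2 ∂(M.area F))
        + 4 * ((∫ x, (pev (uh.velRec (M.left F) i) x - φ x - a (M.left F)) ^ 2 ∂(M.area F))
          + ∫ x, (pev (uh.velRec (M.right F) i) x - φ x - a (M.right F)) ^ 2 ∂(M.area F)) := by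
  have hφc : Continuous φ := hφ.1.continuous
  have hc : ∀ P : Poly d, Continuous (pev P) := continuous_pev
  have hn : ∀ g : Pt d → ℝ, 0 ≤ ∫ x, g x ^ 2 ∂(M.area F) := fun g =>
    integral_nonneg fun x => sq_nonneg _
  set r := uh.velRec
  by_cases hF : M.face F ⊆ frontier Ω
  · have hj : ∀ x, jump M r F i x = pev (r (M.left F) i) x := fun x => by simp [jump, hF]
    -- The face unknown vanishes on a boundary face, so `δ_TF` projects the trace itself.
    have hP : IsL2Proj (M.area F) k (pev (r (M.left F) i)) (uh.deltaTF (M.left F) F i) := by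
      refine ⟨(uh.isL2Proj_deltaTF _ F i).1, fun w hw => ?_⟩
      rw [← (uh.isL2Proj_deltaTF (M.left F) F i).2 w hw]
      refine setIntegral_congr_fun (M.measurableSet_face F) fun x hx => ?_
      simp [hb F hF i x hx, r]
    have h1 := integral_sq_le_proj F (hc _) hP (a (M.left F))
    have h2 : ∫ x, (pev (r (M.left F) i) x - a (M.left F)) ^ 2 ∂(M.area F)
        = ∫ x, (pev (r (M.left F) i) x - φ x - a (M.left F)) ^ 2 ∂(M.area F) := by
      refine setIntegral_congr_fun (M.measurableSet_face F) fun x hx => ?_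
      have h0 : φ x = 0 := by
        by_contra h
        have h3 := hφ.2.2 (subset_tsupport φ h)
        have h4 := hF hx
        rw [hΩ.frontier_eq] at h4
        exact h4.2 h3
      simp [h0]
    simp only [hj]
    rw [h2] at h1
    linarith [hn (pev (uh.deltaTF (M.left F) F i)), hn (pev (uh.deltaTF (M.right F) F i)),
      hn fun x => pev (r (M.left F) i) x - φ x - a (M.left F),
      hn fun x => pev (r (M.right F) i) x - φ x - a (M.right F)]
  · have hj : ∀ x, jump M r F i x = pev (r (M.left F) i) x - pev (r (M.right F) i) x := fun x => by
      simp [jump, hF]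
    have hl := uh.isL2Proj_deltaTF (M.left F) F i
    have hr := uh.isL2Proj_deltaTF (M.right F) F i
    have hsub : ∀ (P Q : Poly d) x, pev (P - Q) x = pev P x - pev Q x := fun P Q x => by simp [pev]
    -- The common face unknown cancels in the difference.
    have hP : IsL2Proj (M.area F) k (fun x => pev (r (M.left F) i) x - pev (r (M.right F) i) x)
        (uh.deltaTF (M.left F) F i - uh.deltaTF (M.right F) F i) := by
      refine ⟨Submodule.sub_mem _ hl.1 hr.1, fun w hw => ?_⟩
      rw [← sub_zero (0 : ℝ)]
      nth_rewrite 1 [← hl.2 w hw]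
      rw [← hr.2 w hw, ← integral_sub
        (M.integrable_area F (by have := hc; fun_prop)) (M.integrable_area F (by fun_prop))]
      congr 1
      ext x
      rw [hsub]
      ring
    have h1 := integral_sq_le_proj F
      (g := fun x => pev (r (M.left F) i) x - pev (r (M.right F) i) x) ((hc _).sub (hc _)) hP (a (M.left F) - a (M.right F))
    have h2 := integral_sq_sub_le F (hc (uh.deltaTF (M.left F) F i))
      (hc (uh.deltaTF (M.right F) F i))
    have h3 := integral_sq_sub_le F
      (g₁ := fun x => pev (r (M.left F) i) x - φ x - a (M.left F))
      (g₂ := fun x => pev (r (M.right F) i) x - φ x - a (M.right F))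
      (((hc (r (M.left F) i)).sub hφc).sub (continuous_const (y := a (M.left F))))
      (((hc (r (M.right F) i)).sub hφc).sub (continuous_const (y := a (M.right F))))
    have h4 : ∀ x, pev (r (M.left F) i) x - φ x - a (M.left F)
          - (pev (r (M.right F) i) x - φ x - a (M.right F))
        = pev (r (M.left F) i) x - pev (r (M.right F) i) x - (a (M.left F) - a (M.right F)) :=
      fun x => by ring
    simp only [h4] at h3
    simp only [hsub] at h1
    simp only [hj]
    linarith

end Jump

/-! ### The velocity: approximation by test functions and incompressibility -/

section Velocity

variable {d : ℕ} {Ω : Set (Pt d)}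

theorem IsTestFun.continuous_partialD {φ : Pt d → ℝ} (hφ : IsTestFun Ω φ) (j : Fin d) :
    Continuous (partialD j φ) :=
  (hφ.1.continuous_fderiv (by simp)).clm_apply continuous_const

theorem IsTestFun.memLp_partialD {φ : Pt d → ℝ} (hφ : IsTestFun Ω φ) (j : Fin d) :
    MemLp (partialD j φ) 2 (volume.restrict Ω) :=
  ((hφ.continuous_partialD j).memLp_of_hasCompactSupport
    (hφ.2.1.fderiv_apply (𝕜 := ℝ) _)).restrict Ω

theorem IsTestFun.integral_partialD {φ : Pt d → ℝ} (hφ : IsTestFun Ω φ) (j : Fin d) :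
    ∫ x in Ω, partialD j φ x = 0 := by
  have hcs : HasCompactSupport (partialD j φ) := hφ.2.1.fderiv_apply (𝕜 := ℝ) _
  have hsub : Function.support (partialD j φ) ⊆ Ω := fun x hx =>
    hφ.2.2 (tsupport_fderiv_subset ℝ (subset_tsupport _ fun h => hx (by simp [partialD, h])))
  rw [setIntegral_eq_integral_of_forall_compl_eq_zero fun x hx => by
    by_contra h
    exact hx (hsub h)]
  have h := integral_mul_fderiv_eq_neg_fderiv_mul_of_integrable (μ := (volume : Measure (Pt d)))
    (f := fun _ => (1 : ℝ)) (g := φ) (v := EuclideanSpace.single j 1) (by simp)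
    (by
      simp only [one_mul]
      exact (hφ.continuous_partialD j).integrable_of_hasCompactSupport hcs)
    (by simpa using hφ.1.continuous.integrable_of_hasCompactSupport hφ.2.1)
    (fun x _ => differentiableAt_const _) (fun x _ => hφ.1.differentiable (by simp) x)
  simpa [partialD] using h

/-- True for test functions, and preserved in the limit since `L²` convergence implies `L¹`
convergence on a set of finite measure. -/
theorem MemH10.integral_grad (hΩ : volume Ω ≠ ⊤) {u : Pt d → ℝ} {G : Pt d → Fin d → ℝ}
    (h : MemH10 Ω u G) (j : Fin d) : ∫ x in Ω, G x j = 0 := by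
  have : IsFiniteMeasure (volume.restrict Ω) := ⟨by simpa using hΩ.lt_top⟩
  obtain ⟨φ, hφ, -, hlim⟩ := h.approx
  have h1 : Tendsto (fun n => eLpNorm (partialD j (φ n) - fun x => G x j) 1 (volume.restrict Ω))
      atTop (𝓝 0) := by
    have h2 := ENNReal.Tendsto.mul_const (b := (volume.restrict Ω) univ ^ (1 / (1 : ℝ≥0∞).toReal
      - 1 / (2 : ℝ≥0∞).toReal)) (hlim j) (Or.inr (by
        refine ENNReal.rpow_ne_top_of_nonneg (by norm_num) (measure_ne_top _ _)))
    rw [zero_mul] at h2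
    refine tendsto_of_tendsto_of_tendsto_of_le_of_le tendsto_const_nhds h2 (fun _ => zero_le) fun n => ?_
    exact eLpNorm_le_eLpNorm_mul_rpow_measure_univ (by norm_num)
      (((hφ n).memLp_partialD j).sub (h.grad_memLp j)).aestronglyMeasurable
  have h3 := tendsto_integral_of_L1' (fun x => G x j) (h.grad_memLp j).aestronglyMeasurable
    (Eventually.of_forall fun n => ((hφ n).memLp_partialD j).integrable (by norm_num)) h1
  simp only [(hφ _).integral_partialD j] at h3
  exact tendsto_nhds_unique h3 tendsto_const_nhds

theorem integral_sq_le_of_eLpNorm_le {α : Type*} [MeasurableSpace α] {μ : Measure α} {g : α → ℝ}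
    (hg : MemLp g 2 μ) {ε : ℝ} (hε : 0 ≤ ε) (h : eLpNorm g 2 μ ≤ ENNReal.ofReal (Real.sqrt ε)) :
    ∫ x, g x ^ 2 ∂μ ≤ ε := by
  rw [hg.eLpNorm_eq_integral_rpow_norm two_ne_zero ENNReal.ofNat_ne_top,
    ENNReal.ofReal_le_ofReal_iff (Real.sqrt_nonneg _)] at h
  simp only [ENNReal.toReal_ofNat, Real.rpow_ofNat, Real.norm_eq_abs, sq_abs] at h
  rw [← one_div, ← Real.sqrt_eq_rpow] at h
  exact (Real.sqrt_le_sqrt_iff hε).1 h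

theorem MemH10.exists_testFun {u : Pt d → ℝ} {G : Pt d → Fin d → ℝ} (h : MemH10 Ω u G) {ε : ℝ}
    (hε : 0 < ε) :
    ∃ φ, IsTestFun Ω φ ∧ ∀ j, ∫ x in Ω, (G x j - partialD j φ x) ^ 2 ≤ ε := by
  obtain ⟨φ, hφ, -, hlim⟩ := h.approx
  have h1 : ∀ᶠ n in atTop, ∀ j, eLpNorm (fun x => partialD j (φ n) x - G x j) 2
      (volume.restrict Ω) ≤ ENNReal.ofReal (Real.sqrt ε) :=
    eventually_all.2 fun j => (hlim j).eventually_le_const (by simpa using Real.sqrt_pos.2 hε)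
  obtain ⟨n, hn⟩ := h1.exists
  refine ⟨φ n, hφ n, fun j => ?_⟩
  have h2 := integral_sq_le_of_eLpNorm_le
    (((hφ n).memLp_partialD j).sub (h.grad_memLp j)) hε.le (hn j)
  refine le_trans (le_of_eq ?_) h2
  congr 1
  ext x
  simp only [Pi.sub_apply]
  ring

/-- The divergence has zero mean because `u` vanishes on the boundary, so it is itself an admissible
test function in the mass equation. -/
theorem IsStokesSolution.div_eq_zero (hΩ : volume Ω ≠ ⊤) {ν : ℝ} {f u : Pt d → Fin d → ℝ}
    {Du : Pt d → Fin d → Fin d → ℝ} {p : Pt d → ℝ} (h : IsStokesSolution Ω ν f u Du p) :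
    ∀ᵐ x ∂(volume.restrict Ω), ∑ i, Du x i i = 0 := by
  have : IsFiniteMeasure (volume.restrict Ω) := ⟨by simpa using hΩ.lt_top⟩
  have hm : MemLp (fun x => ∑ i, Du x i i) 2 (volume.restrict Ω) :=
    memLp_finsetSum _ fun i _ => (h.vel_mem i).grad_memLp i
  have h0 : ∫ x in Ω, ∑ i, Du x i i = 0 := by
    rw [integral_finsetSum _ fun i _ => ((h.vel_mem i).grad_memLp i).integrable (by norm_num)]
    exact Finset.sum_eq_zero fun i _ => (h.vel_mem i).integral_grad hΩ i
  have h1 := h.mass _ ⟨hm, h0⟩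
  have h2 := (integral_eq_zero_iff_of_nonneg (fun x => mul_self_nonneg _)
    (by simpa only [sq] using hm.integrable_sq)).1 h1
  filter_upwards [h2] with x hx
  exact mul_self_eq_zero.1 hx

end Velocity

/-! ### The estimator is bounded by the velocity error -/

section Estimator

variable {d : ℕ} {Ω : Set (Pt d)} {M : Mesh Ω} {k : ℕ}

theorem Mesh.memLp_vol (M : Mesh Ω) (T : Fin M.nElem) {g : Pt d → ℝ} (hg : Continuous g) :
    MemLp g 2 (M.vol T) :=
  (memLp_two_iff_integrable_sq hg.aestronglyMeasurable).2 (M.integrable_vol T (hg.pow 2))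

theorem Mesh.sum_integral_vol_le (M : Mesh Ω) (hΩ : IsPolytope Ω) {g : Pt d → ℝ}
    (hg : IntegrableOn g Ω) (hg0 : ∀ x, 0 ≤ g x) :
    ∑ T, ∫ x, g x ∂(M.vol T) ≤ ∫ x in Ω, g x := by
  rw [← integral_biUnion_finset Finset.univ (fun T _ => (M.elem_polytope T).isOpen.measurableSet)
    (fun T _ T' _ h => M.elem_disjoint T T' h) fun T _ => hg.mono_set (M.elem_subset hΩ T)]
  exact setIntegral_mono_set hg (Eventually.of_forall hg0)
    (iUnion₂_subset fun T _ => M.elem_subset hΩ T).eventuallyLE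

theorem stab_nonneg (v : DiscVel M k) (T : Fin M.nElem) : 0 ≤ stab v v T := by
  refine add_nonneg (mul_nonneg (by positivity) (integral_nonneg fun x =>
    Finset.sum_nonneg fun i _ => mul_self_nonneg _)) (Finset.sum_nonneg fun F _ =>
      mul_nonneg (inv_nonneg.2 Metric.diam_nonneg) (integral_nonneg fun x =>
        Finset.sum_nonneg fun i _ => mul_self_nonneg _))

theorem sum_deltaTF_le_stab (v : DiscVel M k) (T : Fin M.nElem) :
    ∑ F ∈ M.facesOf T, ∑ i, (M.hF F)⁻¹ * ∫ x, pev (v.deltaTF T F i) x ^ 2 ∂(M.area F)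
      ≤ stab v v T := by
  refine le_trans (le_of_eq ?_) (le_add_of_nonneg_left (mul_nonneg (by positivity)
    (integral_nonneg fun x => Finset.sum_nonneg fun i _ => mul_self_nonneg _)))
  refine Finset.sum_congr rfl fun F _ => ?_
  have hi : ∀ i, Integrable (fun x => pev (v.deltaTF T F i) x ^ 2) (M.area F) := fun i =>
    M.integrable_area F ((continuous_pev _).pow 2)
  rw [← Finset.mul_sum, ← integral_finsetSum _ fun i _ => hi i]
  simp only [sq]

theorem continuous_jump (v : Fin M.nElem → Fin d → Poly d) (F : Fin M.nFace) (i : Fin d) :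
    Continuous (jump M v F i) := by
  have hc : ∀ P : Poly d, Continuous (pev P) := continuous_pev
  unfold jump
  split_ifs
  · exact hc _
  · exact (hc _).sub (hc _)

/-- As `div u = 0`, the divergence of the reconstruction is minus the trace of the gradient error;
Cauchy-Schwarz on `d` diagonal terms gives the factor `d`. -/
theorem etaDivSq_le (hΩ : IsPolytope Ω) {ν : ℝ} (hν : 0 ≤ ν) {f u : Pt d → Fin d → ℝ}
    {Du : Pt d → Fin d → Fin d → ℝ} {p : Pt d → ℝ} (h : IsStokesSolution Ω ν f u Du p)
    (uh : DiscVel M k) (T : Fin M.nElem) :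
    etaDivSq ν uh T ≤ d * (ν * ∫ x, ∑ i, ∑ j,
      (Du x i j - pev (MvPolynomial.pderiv j (uh.velRec T i)) x) ^ 2 ∂(M.vol T)) := by
  have hle : M.vol T ≤ volume.restrict Ω := Measure.restrict_mono (M.elem_subset hΩ T) le_rfl
  have hi : ∀ i j, Integrable (fun x =>
      (Du x i j - pev (MvPolynomial.pderiv j (uh.velRec T i)) x) ^ 2) (M.vol T) := fun i j =>
    ((((h.vel_mem i).grad_memLp j).mono_measure hle).sub
      (M.memLp_vol T (continuous_pev _))).integrable_sq
  rw [etaDivSq, mul_left_comm]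
  refine mul_le_mul_of_nonneg_left ?_ hν
  rw [← integral_const_mul]
  refine integral_mono_ae (M.integrable_vol T ((continuous_pev _).pow 2))
    ((integrable_finsetSum _ fun i _ => integrable_finsetSum _ fun j _ => hi i j).const_mul _) ?_
  filter_upwards [ae_mono hle (h.div_eq_zero (volume_lt_top hΩ))] with x hx
  have h1 : pev (pdiv (uh.velRec T)) x
      = - ∑ i, (Du x i i - pev (MvPolynomial.pderiv i (uh.velRec T i)) x) := by
    rw [Finset.sum_sub_distrib, hx]
    simp [pdiv, pev]
  rw [h1, neg_sq]
  refine sq_sum_le_card_mul_sum_sq.trans ?_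
  rw [Finset.card_univ, Fintype.card_fin]
  gcongr with i
  exact Finset.single_le_sum (f := fun j =>
    (Du x i j - pev (MvPolynomial.pderiv j (uh.velRec T i)) x) ^ 2) (fun j _ => sq_nonneg _)
    (Finset.mem_univ i)

end Estimator

/-! ### The jump part of the estimator -/

section EstimatorBound

variable {d : ℕ} [NeZero d] {Ω : Set (Pt d)} {M : Mesh Ω} {k : ℕ}

theorem elemConst_nonneg (d : ℕ) {κ : ℝ} (hκ : 0 < κ) : 0 ≤ elemConst d κ := by
  have := (traceConst_pos d hκ).le
  unfold elemConst cardConst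
  positivity

/-- The gradient of `r - φ` is split through `G`, the weak gradient that `φ` approximates. -/
theorem integral_fderiv_sq_le (T : Fin M.nElem) {r : Poly d} {φ : Pt d → ℝ} (hφ : IsTestFun Ω φ)
    {G : Pt d → Fin d → ℝ} (hG : ∀ j, MemLp (fun x => G x j) 2 (M.vol T)) :
    ∫ x, ‖fderiv ℝ (fun x => pev r x - φ x) x‖ ^ 2 ∂(M.vol T)
      ≤ 2 * (∫ x, ∑ j, (G x j - pev (MvPolynomial.pderiv j r) x) ^ 2 ∂(M.vol T))
        + 2 * ∫ x, ∑ j, (G x j - partialD j φ x) ^ 2 ∂(M.vol T) := by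
  have hi₁ : Integrable (fun x => ∑ j, (G x j - pev (MvPolynomial.pderiv j r) x) ^ 2) (M.vol T) :=
    integrable_finsetSum _ fun j _ => ((hG j).sub (M.memLp_vol T (continuous_pev _))).integrable_sq
  have hi₂ : Integrable (fun x => ∑ j, (G x j - partialD j φ x) ^ 2) (M.vol T) :=
    integrable_finsetSum _ fun j _ =>
      ((hG j).sub (M.memLp_vol T (hφ.continuous_partialD j))).integrable_sq
  rw [← integral_const_mul, ← integral_const_mul, ← integral_add (hi₁.const_mul 2) (hi₂.const_mul 2)]
  have hc : Continuous (fderiv ℝ fun x => pev r x - φ x) :=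
    ((contDiff_pev r).sub hφ.1).continuous_fderiv (by simp)
  refine integral_mono (M.integrable_vol T (hc.norm.pow 2))
    ((hi₁.const_mul 2).add (hi₂.const_mul 2)) fun x => ?_
  change ‖fderiv ℝ (fun x => pev r x - φ x) x‖ ^ 2
    ≤ 2 * ∑ j, (G x j - pev (MvPolynomial.pderiv j r) x) ^ 2
      + 2 * ∑ j, (G x j - partialD j φ x) ^ 2
  refine (norm_sq_le_sum _).trans ?_
  rw [Finset.mul_sum, Finset.mul_sum, ← Finset.sum_add_distrib]
  refine Finset.sum_le_sum fun j _ => ?_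
  rw [fderiv_fun_sub ((contDiff_pev r).differentiable (by simp) x)
    (hφ.1.differentiable (by simp) x), sub_apply, fderiv_pev]
  change (pev (MvPolynomial.pderiv j r) x - partialD j φ x) ^ 2 ≤ _
  nlinarith [sq_nonneg ((G x j - pev (MvPolynomial.pderiv j r) x) + (G x j - partialD j φ x))]

/-- The factor `16 = 2 · 4 · 2`: a face belongs to at most two elements, the bound on one face has
the factor `4`, and the left and right contributions are each bounded by the sum over all elements.
-/
theorem sum_jump_le_faces (hΩ : IsOpen Ω) {uh : DiscVel M k} (hb : uh.VanishesOnBoundary)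
    {φ : Fin d → Pt d → ℝ} (hφ : ∀ i, IsTestFun Ω (φ i)) (a : Fin d → Fin M.nElem → ℝ) :
    ∑ T, ∑ F ∈ M.facesOf T, (M.hF F)⁻¹ * ∫ x, ∑ i, jump M uh.velRec F i x ^ 2 ∂(M.area F)
      ≤ 16 * ((∑ T, ∑ F ∈ M.facesOf T, ∑ i,
            (M.hF F)⁻¹ * ∫ x, pev (uh.deltaTF T F i) x ^ 2 ∂(M.area F))
        + ∑ T, ∑ F ∈ M.facesOf T, ∑ i,
            (M.hF F)⁻¹ * ∫ x, (pev (uh.velRec T i) x - φ i x - a i T) ^ 2 ∂(M.area F)) := by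
  have hh : ∀ F, 0 ≤ (M.hF F)⁻¹ := fun F => inv_nonneg.2 Metric.diam_nonneg
  let X : Fin M.nElem → Fin M.nFace → ℝ := fun T F => ∑ i,
    (M.hF F)⁻¹ * ∫ x, pev (uh.deltaTF T F i) x ^ 2 ∂(M.area F)
  let Y : Fin M.nElem → Fin M.nFace → ℝ := fun T F => ∑ i,
    (M.hF F)⁻¹ * ∫ x, (pev (uh.velRec T i) x - φ i x - a i T) ^ 2 ∂(M.area F)
  have hX : ∀ T F, 0 ≤ X T F := fun T F => Finset.sum_nonneg fun i _ =>
    mul_nonneg (hh F) (integral_nonneg fun x => sq_nonneg _)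
  have hY : ∀ T F, 0 ≤ Y T F := fun T F => Finset.sum_nonneg fun i _ =>
    mul_nonneg (hh F) (integral_nonneg fun x => sq_nonneg _)
  have hl : ∀ F, F ∈ M.facesOf (M.left F) := fun F => Mesh.mem_facesOf.2 (M.face_left F)
  have hr : ∀ F, F ∈ M.facesOf (M.right F) := fun F => Mesh.mem_facesOf.2 (M.face_right F)
  have h1 : ∀ F, (M.hF F)⁻¹ * ∫ x, ∑ i, jump M uh.velRec F i x ^ 2 ∂(M.area F)
      ≤ 4 * (X (M.left F) F + X (M.right F) F) + 4 * (Y (M.left F) F + Y (M.right F) F) := by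
    intro F
    have hi : ∀ i, Integrable (fun x => jump M uh.velRec F i x ^ 2) (M.area F) := fun i =>
      M.integrable_area F ((continuous_jump (M := M) uh.velRec F i).pow 2)
    rw [integral_finsetSum _ fun i _ => hi i, Finset.mul_sum]
    simp only [X, Y, ← Finset.sum_add_distrib, Finset.mul_sum]
    refine Finset.sum_le_sum fun i _ => ?_
    refine (mul_le_mul_of_nonneg_left (integral_jump_sq_le hΩ hb (hφ i) F i (a i)) (hh F)).trans
      (le_of_eq ?_)
    ring
  calc _ ≤ 2 * ∑ F, (M.hF F)⁻¹ * ∫ x, ∑ i, jump M uh.velRec F i x ^ 2 ∂(M.area F) :=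
        M.sum_facesOf_le fun F => mul_nonneg (hh F) (integral_nonneg fun x =>
          Finset.sum_nonneg fun i _ => sq_nonneg _)
    _ ≤ 2 * ∑ F, (4 * (X (M.left F) F + X (M.right F) F)
          + 4 * (Y (M.left F) F + Y (M.right F) F)) := by
        gcongr with F
        exact h1 F
    _ ≤ _ := by
        change _ ≤ 16 * ((∑ T, ∑ F ∈ M.facesOf T, X T F) + ∑ T, ∑ F ∈ M.facesOf T, Y T F)
        rw [Finset.sum_add_distrib, ← Finset.mul_sum, ← Finset.mul_sum, Finset.sum_add_distrib,
          Finset.sum_add_distrib]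
        linarith [M.sum_faces_le hX hl, M.sum_faces_le hX hr, M.sum_faces_le hY hl,
          M.sum_faces_le hY hr]

/-- The parameter `ρ²` combines `r_S ≥ ρ h_S` with `h_S ≥ ρ h_T`. -/
theorem sum_faces_poincare_le (hd : 2 ≤ d) {ρ : ℝ} (hρ : 0 < ρ) (hM : M.IsRegular ρ)
    (T : Fin M.nElem) {w : Pt d → ℝ} (hw : ContDiff ℝ 1 w) :
    ∃ a : ℝ, ∑ F ∈ M.facesOf T, (M.hF F)⁻¹ * ∫ x, (w x - a) ^ 2 ∂(M.area F)
      ≤ elemConst d (ρ ^ 2) * ∫ x, ‖fderiv ℝ w x‖ ^ 2 ∂(M.vol T) := by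
  obtain ⟨K, hK, hK'⟩ := hM
  refine exists_sum_faces_le (K := K) hd (by positivity) (fun S hS => ?_) hw
  refine le_trans ?_ (hK S)
  rw [sq, mul_assoc]
  exact mul_le_mul_of_nonneg_left (hK' T S (Submesh.mem_inElem.1 hS)) hρ.le

/-- The test functions and the element constants depend on `ε`, but the constant in the bound does
not, so `ε` can be sent to zero. -/
theorem sum_jump_le (hd : 2 ≤ d) {ρ : ℝ} (hρ : 0 < ρ) (hΩ : IsPolytope Ω) (hM : M.IsRegular ρ)
    {ν : ℝ} {f u : Pt d → Fin d → ℝ} {Du : Pt d → Fin d → Fin d → ℝ} {p : Pt d → ℝ}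
    (h : IsStokesSolution Ω ν f u Du p) {uh : DiscVel M k} (hb : uh.VanishesOnBoundary) :
    ∑ T, ∑ F ∈ M.facesOf T, (M.hF F)⁻¹ * ∫ x, ∑ i, jump M uh.velRec F i x ^ 2 ∂(M.area F)
      ≤ 16 * (∑ T, stab uh uh T) + 32 * elemConst d (ρ ^ 2) * ∑ T, ∫ x, ∑ i, ∑ j,
        (Du x i j - pev (MvPolynomial.pderiv j (uh.velRec T i)) x) ^ 2 ∂(M.vol T) := by
  have hC := elemConst_nonneg d (show 0 < ρ ^ 2 by positivity)
  set C := elemConst d (ρ ^ 2)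
  have hle : ∀ T, M.vol T ≤ volume.restrict Ω := fun T =>
    Measure.restrict_mono (M.elem_subset hΩ T) le_rfl
  have hDu : ∀ T i j, MemLp (fun x => Du x i j) 2 (M.vol T) := fun T i j =>
    ((h.vel_mem i).grad_memLp j).mono_measure (hle T)
  have hd0 : (0 : ℝ) < d := Nat.cast_pos.2 (NeZero.pos d)
  refine le_of_forall_pos_le_add fun ε hε => ?_
  -- Makes the total approximation error `32 C d² ε'` at most `ε`; `C + 1` replaces `C` because `C`
  -- is only known to be nonnegative.
  set ε' := ε / (32 * (C + 1) * d * d) with hε'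
  have hε'0 : 0 < ε' := by positivity
  choose φ hφ hφε using fun i => (h.vel_mem i).exists_testFun hε'0
  choose a ha using fun (i : Fin d) (T : Fin M.nElem) => sum_faces_poincare_le hd hρ hM T
    (w := fun x => pev (uh.velRec T i) x - φ i x)
    (((contDiff_pev _).sub (hφ i).1).of_le (by simp))
  have h1 : ∑ T, ∑ F ∈ M.facesOf T, ∑ i,
      (M.hF F)⁻¹ * ∫ x, (pev (uh.velRec T i) x - φ i x - a i T) ^ 2 ∂(M.area F)
      ≤ 2 * C * (∑ T, ∫ x, ∑ i, ∑ j,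
        (Du x i j - pev (MvPolynomial.pderiv j (uh.velRec T i)) x) ^ 2 ∂(M.vol T))
        + 2 * C * ∑ T, ∑ i, ∫ x, ∑ j, (Du x i j - partialD j (φ i) x) ^ 2 ∂(M.vol T) := by
    rw [Finset.mul_sum, Finset.mul_sum, ← Finset.sum_add_distrib]
    refine Finset.sum_le_sum fun T _ => ?_
    have hi : ∀ i, Integrable (fun x => ∑ j,
        (Du x i j - pev (MvPolynomial.pderiv j (uh.velRec T i)) x) ^ 2) (M.vol T) := fun i =>
      integrable_finsetSum _ fun j _ =>
        ((hDu T i j).sub (M.memLp_vol T (continuous_pev _))).integrable_sq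
    rw [Finset.sum_comm, integral_finsetSum _ fun i _ => hi i, Finset.mul_sum, Finset.mul_sum,
      ← Finset.sum_add_distrib]
    refine Finset.sum_le_sum fun i _ => (ha i T).trans ?_
    refine (mul_le_mul_of_nonneg_left
      (integral_fderiv_sq_le T (hφ i) fun j => hDu T i j) hC).trans (le_of_eq ?_)
    ring
  have h2 : ∑ T, ∑ i, ∫ x, ∑ j, (Du x i j - partialD j (φ i) x) ^ 2 ∂(M.vol T) ≤ d * (d * ε') := by
    rw [Finset.sum_comm]
    refine (Finset.sum_le_card_nsmul _ _ (d * ε') fun i _ => ?_).trans (by simp)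
    have hi : ∀ j, Integrable (fun x => (Du x i j - partialD j (φ i) x) ^ 2)
        (volume.restrict Ω) := fun j =>
      (((h.vel_mem i).grad_memLp j).sub ((hφ i).memLp_partialD j)).integrable_sq
    refine (M.sum_integral_vol_le hΩ (integrable_finsetSum _ fun j _ => hi j)
      fun x => Finset.sum_nonneg fun j _ => sq_nonneg _).trans ?_
    rw [integral_finsetSum _ fun j _ => hi j]
    exact (Finset.sum_le_card_nsmul _ _ ε' fun j _ => hφε i j).trans (by simp)
  have h3 := sum_jump_le_faces hΩ.isOpen hb hφ a
  have h4 := Finset.sum_le_sum fun T (_ : T ∈ Finset.univ) => sum_deltaTF_le_stab uh T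
  have h5 : 32 * C * (d * (d * ε')) ≤ ε := by
    rw [hε', show 32 * C * (d * (d * (ε / (32 * (C + 1) * d * d)))) = C / (C + 1) * ε by
      field_simp]
    exact mul_le_of_le_one_left hε.le (div_le_one_of_le₀ (by linarith) (by linarith))
  have h6 := mul_le_mul_of_nonneg_left h2 (show 0 ≤ 32 * C by positivity)
  linarith

end EstimatorBound

end StokesHHO

end

/-! ### Efficiency of the estimator -/

theorem mainTheorem3 (d : ℕ) [NeZero d] (hd : d = 2 ∨ d = 3) (k : ℕ)
    (ρ : ℝ) (hρ0 : 0 < ρ) (hρ1 : ρ < 1) :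
    ∃ C : ℝ, 0 < C ∧
      ∀ (Ω : Set (StokesHHO.Pt d)), StokesHHO.IsPolytope Ω → SimplyConnectedSpace Ω →
      ∀ (M : StokesHHO.Mesh Ω), M.IsRegular ρ →
      ∀ (ν : ℝ), 0 < ν →
      ∀ (f : StokesHHO.Pt d → Fin d → ℝ), (∀ i, MemLp (fun x => f x i) 2 (volume.restrict Ω)) →
      ∀ (u : StokesHHO.Pt d → Fin d → ℝ) (Du : StokesHHO.Pt d → Fin d → Fin d → ℝ)
        (p : StokesHHO.Pt d → ℝ), StokesHHO.IsStokesSolution Ω ν f u Du p →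
      ∀ (uh : StokesHHO.DiscVel M k) (ph : StokesHHO.DiscPres M k),
        StokesHHO.IsHHOSolution ν f uh ph →
        StokesHHO.etaSq ν uh ≤ C * (StokesHHO.errVelSq ν Du uh + StokesHHO.errPresSq ν p ph
          + StokesHHO.oscSq M k ν f) := by
  have hd2 : 2 ≤ d := by omega
  have hC := StokesHHO.elemConst_nonneg d (show 0 < ρ ^ 2 by positivity)
  set C := StokesHHO.elemConst d (ρ ^ 2)
  -- `d` from the divergence, `17 = 1 + 16` from the stabilization itself and its share of the
  -- jumps, `32 C` from the gradient part of the jumps.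
  refine ⟨d + 17 + 32 * C, by positivity, ?_⟩
  intro Ω hΩ _ M hM ν hν f _ u Du p hu uh ph huh
  set E := ∑ T, ∫ x, ∑ i, ∑ j,
    (Du x i j - StokesHHO.pev (MvPolynomial.pderiv j (uh.velRec T i)) x) ^ 2 ∂(M.vol T) with hE
  set s := ∑ T, StokesHHO.stab uh uh T with hs
  have hE0 : 0 ≤ E := Finset.sum_nonneg fun T _ => integral_nonneg fun x =>
    Finset.sum_nonneg fun i _ => Finset.sum_nonneg fun j _ => sq_nonneg _
  have hs0 : 0 ≤ s := Finset.sum_nonneg fun T _ => StokesHHO.stab_nonneg uh T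
  have hvel : StokesHHO.errVelSq ν Du uh = ν * E + ν * s := by
    rw [StokesHHO.errVelSq, Finset.sum_add_distrib, ← Finset.mul_sum, ← Finset.mul_sum]
  have hpres : 0 ≤ StokesHHO.errPresSq ν p ph := Finset.sum_nonneg fun T _ =>
    mul_nonneg (inv_nonneg.2 hν.le) (integral_nonneg fun x => sq_nonneg _)
  have hosc : 0 ≤ StokesHHO.oscSq M k ν f := Finset.sum_nonneg fun T _ =>
    mul_nonneg (mul_nonneg (inv_nonneg.2 hν.le) (sq_nonneg _)) (integral_nonneg fun x =>
      Finset.sum_nonneg fun i _ => sq_nonneg _)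
  have hdiv : ∑ T, StokesHHO.etaDivSq ν uh T ≤ d * (ν * E) := by
    rw [hE, Finset.mul_sum, Finset.mul_sum]
    exact Finset.sum_le_sum fun T _ => StokesHHO.etaDivSq_le hΩ hν.le hu uh T
  have hstab : ∑ T, StokesHHO.etaStabSq ν uh T = ν * s := by
    rw [hs, Finset.mul_sum]; rfl
  have hjump : ∑ T, StokesHHO.etaJumpSq ν uh T ≤ ν * (16 * s + 32 * C * E) := by
    simp only [StokesHHO.etaJumpSq, ← Finset.mul_sum]
    exact mul_le_mul_of_nonneg_left
      (StokesHHO.sum_jump_le hd2 hρ0 hΩ hM hu huh.boundary) hν.le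
  have h1 : 0 ≤ ν * E := by positivity
  have h2 : 0 ≤ ν * s := by positivity
  have h3 : 0 ≤ C * (ν * s) := by positivity
  have h4 : 0 ≤ d * (ν * s) := by positivity
  calc StokesHHO.etaSq ν uh ≤ (d + 17 + 32 * C) * StokesHHO.errVelSq ν Du uh := by
        rw [StokesHHO.etaSq, hstab, hvel]
        linarith
    _ ≤ _ := by gcongr; linarith
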